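/- **Setting.** Let $N\in\mathbb N$, let $\frac1p+\frac1q=1$ with $q\in(1,\infty]$, let $A$ (the action space) be a Borel space that is a subset of a real vector space, let the state space be $\mathbb R$, and let $\mathcal Z$ be a measurable space. For each stage $n=0,\dots,N-1$ let there be given: * a measurable set $D_n\subseteq\mathbb R\times A$ containing the graph of a measurable map $\mathbb R\to A$; put $D_n(x)=\{a:(x,a)\in D_n\}$; * a measurable transition function $T_n:D_n\times\mathcal Z\to\mathbb R$ and a one-stage cost $c_n:D_n\times\mathbb R\to\mathbb R$; * a separable probability measure $\mathbb P_{n+1}$ on $\mathcal Z$ (the reference law of the disturbance $Z_{n+1}$) and a non-empty ambiguity set $\mathcal Q_{n+1}$ of probability measures $\mathbb Q\ll\mathbb P_{n+1}$ with $\frac{d\mathbb Q}{d\mathbb P_{n+1}}\in L^q(\mathbb P_{n+1})$. Measures are identified with their densities, and $\mathcal Q_{n+1}$ carries the trace of the weak* topology $\sigma(L^q,L^p)$ and its Borel $\sigma$-algebra. Let further $c_N:\mathbb R\to\mathbb R$ be a terminal cost. Assume: 1. (Bounding functions.) There are $\alpha,\underline\epsilon,\bar\epsilon\ge0$ with $\alpha\ne1$,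 $\underline\epsilon+\bar\epsilon=1$ and measurable $\underline b:\mathbb R\to(-\infty,-\underline\epsilon]$, $\bar b:\mathbb R\to[\bar\epsilon,\infty)$ such that for all $n$, all $\mathbb Q\in\mathcal Q_{n+1}$ and all $(x,a)\in D_n$ $$\mathbb E^{\mathbb Q}[-c_n^-(x,a,T_n(x,a,Z_{n+1}))]\ge\underline b(x),\qquad \mathbb E^{\mathbb Q}[\underline b(T_n(x,a,Z_{n+1}))]\ge\alpha\underline b(x),$$ $$\mathbb E^{\mathbb Q}[c_n^+(x,a,T_n(x,a,Z_{n+1}))]\le\bar b(x),\qquad \mathbb E^{\mathbb Q}[\bar b(T_n(x,a,Z_{n+1}))]\le\alpha\bar b(x),$$ and $\underline b\le c_N\le\bar b$. With $b=\bar b-\underline b$, every $(\bar x,\bar a)\in D_n$ has a neighbourhood in $D_n$ on which $|c_n(x,a,T_n(x,a,z))|\le\Theta_1(z)$ and $b(T_n(x,a,z))\le\Theta_2(z)$ for all $z\in\mathcal Z$, where $\Theta_1,\Theta_2:\mathcal Z\to[0,\infty)$ are measurable functions in $L^p(\mathbb P_{n+1})$, which may depend on $n$ and $(\bar x,\bar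 a)$. The densities of all members of the sets $\mathcal Q_{n+1}$ are bounded in $L^q$-norm by a common constant. 2. (Semicontinuity, compactness, monotonicity.) The sets $D_n(x)$ are compact; if $x_k\to x$ and $a_k\in D_n(x_k)$, then $(a_k)$ has an accumulation point in $D_n(x)$; $(x,a)\mapsto T_n(x,a,z)$ is lower semicontinuous for every $z$; $c_n$ and $c_N$ are lower semicontinuous. Moreover $x\mapsto D_n(x)$ is decreasing with respect to inclusion, and $x\mapsto T_n(x,a,z)$, $(x,x')\mapsto c_n(x,a,x')$ and $c_N$ are increasing (wherever $a\in D_n(x)$). 3. (Convex model.) The sets $D_n$ and the functions $(x,a)\mapsto T_n(x,a,z)$ (for every $z$), $(x,a,x')\mapsto c_n(x,a,x')$ and $c_N$ are convex. 4. The ambiguity sets $\mathcal Q_{n+1}$ are convex and weak* closed. **Policies and values.** All policies are sequences, indexed by $n=0,\dots,N-1$, of measurable decision rules: $\Pi(\mathbb R)$ consists of the $\pi=(d_n)$ with $d_n:\mathbb R\to A$, $d_n(x)\in D_n(x)$; $\Pi(\mathbb R,\mathcal Q)$ of the $\pi=(d_n)$ with $d_n:\mathbb R\times\mathcal Q_{n+1}\to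 A$, $d_n(x,\mathbb Q)\in D_n(x)$; $\Gamma(\mathbb R)$ of the $\gamma=(\gamma_n)$ with $\gamma_n:\mathbb R\to\mathcal Q_{n+1}$; $\Gamma(\mathbb R,A)$ of the $\gamma=(\gamma_n)$ with $\gamma_n:\mathbb R\times A\to\mathcal Q_{n+1}$. A pair in $\Pi(\mathbb R)\times\Gamma(\mathbb R,A)$, $\Pi(\mathbb R,\mathcal Q)\times\Gamma(\mathbb R)$ or $\Pi(\mathbb R)\times\Gamma(\mathbb R)$ determines in state $x$ at time $n$ an action $a$ and a disturbance law $\mathbb Q$, namely $a=d_n(x)$, $\mathbb Q=\gamma_n(x,a)$, respectively $\mathbb Q=\gamma_n(x)$, $a=d_n(x,\mathbb Q)$, respectively $a=d_n(x)$, $\mathbb Q=\gamma_n(x)$. The next state is $T_n(x,a,Z_{n+1})$ with $Z_{n+1}\sim\mathbb Q$. Let $J_{n\pi\gamma}(x)$ be the expectation of $\sum_{k=n}^{N-1}c_k(X_k,A_k,X_{k+1})+c_N(X_N)$ for the resulting process started in $X_n=x$, and $$J_n(x)=\inf_{\pi\in\Pi(\mathbb R)}\sup_{\gamma\in\Gamma(\mathbb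 R,A)}J_{n\pi\gamma}(x),\qquad \widetilde J_n(x)=\sup_{\gamma\in\Gamma(\mathbb R)}\inf_{\pi\in\Pi(\mathbb R,\mathcal Q)}J_{n\pi\gamma}(x).$$ **Claim.** For all $n=0,\dots,N$ and $x\in\mathbb R$, $$J_n(x)=\min_{\pi\in\Pi(\mathbb R)}\max_{\gamma\in\Gamma(\mathbb R,A)}J_{n\pi\gamma}(x)=\max_{\gamma\in\Gamma(\mathbb R)}\min_{\pi\in\Pi(\mathbb R,\mathcal Q)}J_{n\pi\gamma}(x)=\widetilde J_n(x)$$ and $$J_n(x)=\min_{\pi\in\Pi(\mathbb R)}\max_{\gamma\in\Gamma(\mathbb R)}J_{n\pi\gamma}(x)=\max_{\gamma\in\Gamma(\mathbb R)}\min_{\pi\in\Pi(\mathbb R)}J_{n\pi\gamma}(x).$$ Here "min max" means that the inner supremum is attained for every $\pi$ and the outer infimum is attained; "max min" means that the outer supremum is attained at some $\gamma$ for which the inner infimum is attained as well. Moreover there is a Nash equilibrium in deterministic Markov policies: there are $\hat\pi\in\Pi(\mathbb R)$ and $\hat\gamma\in\Gamma(\mathbb R)$, not depending on $n$ and $x$,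 with $$J_{n\hat\pi\gamma}(x)\le J_{n\hat\pi\hat\gamma}(x)=J_n(x)\le J_{n\pi\hat\gamma}(x)\qquad\text{for all } \pi\in\Pi(\mathbb R),\ \gamma\in\Gamma(\mathbb R),\ n=0,\dots,N,\ x\in\mathbb R.$$ -/

import Mathlib

open MeasureTheory Set Filter Topology
open scoped ENNReal

noncomputable section

namespace RobustGame

/-! ### Spaces of probability measures with `L^q` densities and the weak* topology -/

/-- The weak* topology `σ(L^q, L^p)` on `L^q(μ)`: the coarsest topology for which
`f ↦ ∫ f g dμ` is continuous for every `g ∈ L^p(μ)`. -/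
@[reducible] def weakStar {Z : Type*} [MeasurableSpace Z] (p q : ℝ≥0∞) (μ : Measure Z) :
    TopologicalSpace (Lp ℝ q μ) :=
  TopologicalSpace.induced (fun (f : Lp ℝ q μ) (g : Lp ℝ p μ) => ∫ z, f z * g z ∂μ)
    inferInstance

/-- `M^q(μ)`: the probability measures that are absolutely continuous with respect to `μ` and
whose density with respect to `μ` lies in `L^q(μ)`. The conjugate exponent `p` is carried along
because the topology put on this space depends on it. -/
structure Mq {Z : Type*} [MeasurableSpace Z] (p q : ℝ≥0∞) (μ : Measure Z) where
  /-- the underlying measure -/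
  meas : Measure Z
  isProb : IsProbabilityMeasure meas
  absCont : meas ≪ μ
  memLp : MemLp (fun z => (meas.rnDeriv μ z).toReal) q μ

/-- The density of a member of `M^q(μ)`, as an element of `L^q(μ)`. -/
def Mq.density {Z : Type*} [MeasurableSpace Z] {p q : ℝ≥0∞} {μ : Measure Z}
    (ν : Mq p q μ) : Lp ℝ q μ :=
  ν.memLp.toLp

/-- `M^q(μ)` is identified with a set of densities and carries the trace of the weak* topology. -/
instance {Z : Type*} [MeasurableSpace Z] (p q : ℝ≥0∞) (μ : Measure Z) :
    TopologicalSpace (Mq p q μ) :=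
  TopologicalSpace.induced Mq.density (weakStar p q μ)

/-- The Borel `σ`-algebra of the weak* topology. -/
instance {Z : Type*} [MeasurableSpace Z] (p q : ℝ≥0∞) (μ : Measure Z) :
    MeasurableSpace (Mq p q μ) :=
  borel (Mq p q μ)

/-! ### The model -/

/-- The data of a distributionally robust Markov decision model with state space `ℝ`, action
space `A`, disturbance space `Z` and horizon `N`. Stages are `k = 0, …, N - 1`; the disturbance
that drives the transition from stage `k` to stage `k + 1` has reference law `P k` and ambiguity
set `Q k` (these are often written with the index `k + 1`). The functions `T k` and `c k` matter
only at the admissible pairs `(x, a) ∈ D k`. -/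
structure Model (N : ℕ) (A Z : Type*) [MeasurableSpace Z] (p q : ℝ≥0∞) where
  /-- admissible state-action pairs -/
  D : Fin N → Set (ℝ × A)
  /-- transition functions -/
  T : Fin N → ℝ × A → Z → ℝ
  /-- one-stage costs `c k (x, a) x'` -/
  c : Fin N → ℝ × A → ℝ → ℝ
  /-- terminal cost -/
  cN : ℝ → ℝ
  /-- reference laws of the disturbances -/
  P : Fin N → Measure Z
  /-- ambiguity sets -/
  Q : ∀ k, Set (Mq p q (P k))

namespace Model

variable {N : ℕ} {A Z : Type*} [MeasurableSpace Z] {p q : ℝ≥0∞}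

/-- Standing requirements on the data. -/
structure Standing [MeasurableSpace A] (M : Model N A Z p q) : Prop where
  measurableSet_D : ∀ k, MeasurableSet (M.D k)
  exists_selector : ∀ k, ∃ d : ℝ → A, Measurable d ∧ ∀ x, (x, d x) ∈ M.D k
  measurable_T : ∀ k, Measurable (fun y : M.D k × Z => M.T k y.1 y.2)
  isProb_P : ∀ k, IsProbabilityMeasure (M.P k)
  separable_P : ∀ k, IsSeparable (M.P k)
  nonempty_Q : ∀ k, (M.Q k).Nonempty

/-- Integrability: `blo ≤ 0 ≤ bup` are lower and upper bounding functions, there are local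
`L^p`-bounds, and the ambiguity sets are norm bounded. In the local bounds, "for all `(x, a) ∈ D k` in
some ball around the given point" is expressed through the neighbourhoods of that point in `D k`,
so that no product metric has to be chosen. -/
structure Bounding [TopologicalSpace A] (M : Model N A Z p q) : Prop where
  bounds : ∃ (α εlo εup : ℝ) (blo bup : ℝ → ℝ),
    0 ≤ α ∧ 0 ≤ εlo ∧ 0 ≤ εup ∧ εlo + εup = 1 ∧ α ≠ 1 ∧ Measurable blo ∧ Measurable bup ∧
    (∀ x, blo x ≤ -εlo) ∧ (∀ x, εup ≤ bup x) ∧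
    (∀ k, ∀ ν ∈ M.Q k, ∀ y ∈ M.D k,
      blo y.1 ≤ ∫ z, -max (-M.c k y (M.T k y z)) 0 ∂ν.meas ∧
      α * blo y.1 ≤ ∫ z, blo (M.T k y z) ∂ν.meas ∧
      ∫ z, max (M.c k y (M.T k y z)) 0 ∂ν.meas ≤ bup y.1 ∧
      ∫ z, bup (M.T k y z) ∂ν.meas ≤ α * bup y.1) ∧
    (∀ x, blo x ≤ M.cN x ∧ M.cN x ≤ bup x) ∧
    ∀ k, ∀ y₀ ∈ M.D k, ∃ Θ₁ Θ₂ : Z → ℝ,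
      Measurable Θ₁ ∧ Measurable Θ₂ ∧ (∀ z, 0 ≤ Θ₁ z) ∧ (∀ z, 0 ≤ Θ₂ z) ∧
      MemLp Θ₁ p (M.P k) ∧ MemLp Θ₂ p (M.P k) ∧
      ∀ᶠ y in 𝓝[M.D k] y₀, ∀ z,
        |M.c k y (M.T k y z)| ≤ Θ₁ z ∧ bup (M.T k y z) - blo (M.T k y z) ≤ Θ₂ z
  normBounded : ∃ K : ℝ, ∀ k, ∀ ν ∈ M.Q k, ‖ν.density‖ ≤ K

/-- Semicontinuity, compactness and monotonicity on the real line. -/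
structure RealLine [TopologicalSpace A] (M : Model N A Z p q) : Prop where
  isCompact_D : ∀ k x, IsCompact {a | (x, a) ∈ M.D k}
  usc_D : ∀ k (xs : ℕ → ℝ) (as : ℕ → A) (x : ℝ), Tendsto xs atTop (𝓝 x) →
    (∀ j, (xs j, as j) ∈ M.D k) → ∃ a, (x, a) ∈ M.D k ∧ MapClusterPt a atTop as
  lsc_T : ∀ k z, LowerSemicontinuousOn (fun y => M.T k y z) (M.D k)
  lsc_c : ∀ k, LowerSemicontinuousOn (fun w : (ℝ × A) × ℝ => M.c k w.1 w.2) (M.D k ×ˢ univ)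
  lsc_cN : LowerSemicontinuous M.cN
  antitone_D : ∀ k, Antitone (fun x => {a | (x, a) ∈ M.D k})
  mono_T : ∀ k a z, MonotoneOn (fun x => M.T k (x, a) z) {x | (x, a) ∈ M.D k}
  mono_c : ∀ k a, MonotoneOn (fun w : ℝ × ℝ => M.c k (w.1, a) w.2)
    ({x | (x, a) ∈ M.D k} ×ˢ univ)
  mono_cN : Monotone M.cN

/-- `f` is convex on `S`, where points are combined convexly after applying the map `φ` into a
real vector space. -/
def ConvexVia {X W : Type*} [AddCommGroup W] [Module ℝ W] (φ : X → W) (S : Set X)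
    (f : X → ℝ) : Prop :=
  ∀ u ∈ S, ∀ v ∈ S, ∀ w ∈ S, ∀ s t : ℝ, 0 ≤ s → 0 ≤ t → s + t = 1 →
    φ w = s • φ u + t • φ v → f w ≤ s * f u + t * f v

/-- Convex model; `ι` exhibits the action space as a subset of the real vector space `V`. -/
structure IsConvex {V : Type*} [AddCommGroup V] [Module ℝ V] (ι : A ↪ V)
    (M : Model N A Z p q) : Prop where
  convex_D : ∀ k, Convex ℝ ((fun y : ℝ × A => (y.1, ι y.2)) '' M.D k)
  convex_T : ∀ k z, ConvexVia (fun y : ℝ × A => (y.1, ι y.2)) (M.D k) (fun y => M.T k y z)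
  convex_c : ∀ k, ConvexVia (fun w : (ℝ × A) × ℝ => (w.1.1, ι w.1.2, w.2)) (M.D k ×ˢ univ)
    (fun w => M.c k w.1 w.2)
  convex_cN : ConvexOn ℝ univ M.cN

/-! ### Policies -/

/-- `Π(ℝ)`: decision rules of the controller that depend on the state. -/
def ctrlX [MeasurableSpace A] (M : Model N A Z p q) : Set (Fin N → ℝ → A) :=
  {π | ∀ k, Measurable (π k) ∧ ∀ x, (x, π k x) ∈ M.D k}

/-- `Π(ℝ, 𝒬)`: decision rules of the controller that depend on the state and on the measure
chosen by nature. -/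
def ctrlXQ [MeasurableSpace A] (M : Model N A Z p q) : Set (∀ k, ℝ × M.Q k → A) :=
  {π | ∀ k, Measurable (π k) ∧ ∀ x ν, (x, π k (x, ν)) ∈ M.D k}

/-- `Γ(ℝ)`: decision rules of nature that depend on the state. -/
def natX (M : Model N A Z p q) : Set (∀ k, ℝ → M.Q k) :=
  {γ | ∀ k, Measurable (γ k)}

/-- `Γ(ℝ, A)`: decision rules of nature that depend on the state and on the controller's
action. -/
def natXA [MeasurableSpace A] (M : Model N A Z p q) : Set (∀ k, ℝ × A → M.Q k) :=
  {γ | ∀ k, Measurable (γ k)}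

/-! ### Law of motion and policy values

Once both players have fixed deterministic Markov rules, of whichever type, the action and the
disturbance law used at stage `k` in state `x` are functions `act k x` and `amb k x` of `x`. -/

/-- Law of the next state `X_{k+1}` given `X_k = x`: the image of the chosen disturbance law under
the transition function. -/
def step (M : Model N A Z p q) (act : Fin N → ℝ → A) (amb : ∀ k, ℝ → M.Q k)
    (k : Fin N) (x : ℝ) : Measure ℝ :=
  ((amb k x : Mq p q (M.P k)).meas).map (M.T k (x, act k x))

/-- Law of the state process from time `n` on, given `X_n = x`: coordinate `j ≥ n` of the path is
`X_j`. It is `δ_x` at time `n`, followed by the transition laws of stages `n, …, N - 1`.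
The coordinates `j < n` of the path are irrelevant. -/
def law (M : Model N A Z p q) (act : Fin N → ℝ → A) (amb : ∀ k, ℝ → M.Q k) :
    Fin (N + 1) → ℝ → Measure (Fin (N + 1) → ℝ) :=
  Fin.reverseInduction (motive := fun _ => ℝ → Measure (Fin (N + 1) → ℝ))
    (fun x => Measure.dirac (fun _ => x))
    (fun k ih x => (M.step act amb k x).bind fun x' =>
      (ih x').map (fun ω => Function.update ω k.castSucc x))

/-- Total cost from time `n` on along the state path `ω`. -/
def totalCost (M : Model N A Z p q) (act : Fin N → ℝ → A) (n : Fin (N + 1))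
    (ω : Fin (N + 1) → ℝ) : ℝ :=
  (∑ k : Fin N with n ≤ k.castSucc,
    M.c k (ω k.castSucc, act k (ω k.castSucc)) (ω k.succ)) + M.cN (ω (Fin.last N))

/-- Expected total cost from time `n` on, given `X_n = x`. -/
def value (M : Model N A Z p q) (act : Fin N → ℝ → A) (amb : ∀ k, ℝ → M.Q k)
    (n : Fin (N + 1)) (x : ℝ) : ℝ :=
  ∫ ω, M.totalCost act n ω ∂(M.law act amb n x)

/-- `J_{nπγ}(x)` for `π ∈ Π(ℝ)`, `γ ∈ Γ(ℝ, A)`: nature reacts to the action. -/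
def valueCtrlFirst (M : Model N A Z p q) (n : Fin (N + 1)) (x : ℝ)
    (π : Fin N → ℝ → A) (γ : ∀ k, ℝ × A → M.Q k) : ℝ :=
  M.value π (fun k x => γ k (x, π k x)) n x

/-- `J_{nπγ}(x)` for `γ ∈ Γ(ℝ)`, `π ∈ Π(ℝ, 𝒬)`: the controller reacts to the measure. -/
def valueNatFirst (M : Model N A Z p q) (n : Fin (N + 1)) (x : ℝ)
    (γ : ∀ k, ℝ → M.Q k) (π : ∀ k, ℝ × M.Q k → A) : ℝ :=
  M.value (fun k x => π k (x, γ k x)) γ n x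

/-- `J_{nπγ}(x)` for `π ∈ Π(ℝ)`, `γ ∈ Γ(ℝ)`: both players see only the state. -/
def valueSim (M : Model N A Z p q) (n : Fin (N + 1)) (x : ℝ)
    (π : Fin N → ℝ → A) (γ : ∀ k, ℝ → M.Q k) : ℝ :=
  M.value π γ n x

/-- The value function `J_n` of the game in which the controller moves first. -/
def J [MeasurableSpace A] (M : Model N A Z p q) (n : Fin (N + 1)) (x : ℝ) : EReal :=
  ⨅ π ∈ M.ctrlX, ⨆ γ ∈ M.natXA, (M.valueCtrlFirst n x π γ : EReal)

/-- The value function `J̃_n` of the game in which nature moves first. -/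
def Jtilde [MeasurableSpace A] (M : Model N A Z p q) (n : Fin (N + 1)) (x : ℝ) : EReal :=
  ⨆ γ ∈ M.natX, ⨅ π ∈ M.ctrlXQ, (M.valueNatFirst n x γ π : EReal)

end Model

/-- `v = min_{a ∈ S} max_{b ∈ G} f a b`: the maximum over `b` is attained for every `a ∈ S`, and
the minimum over `a` of these maxima is attained and equals `v`. -/
def IsMinMax {α β : Type*} (S : Set α) (G : Set β) (f : α → β → ℝ) (v : EReal) : Prop :=
  (∀ a ∈ S, ∃ b ∈ G, IsMaxOn (f a) G b) ∧
  IsLeast ((fun a => ⨆ b ∈ G, (f a b : EReal)) '' S) v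

/-- `v = max_{b ∈ G} min_{a ∈ S} f b a`: the supremum over `b` of the infima over `a` equals `v`
and is attained at some `b₀ ∈ G` for which the infimum over `a` is attained as well. -/
def IsMaxMin {α β : Type*} (G : Set β) (S : Set α) (f : β → α → ℝ) (v : EReal) : Prop :=
  IsGreatest ((fun b => ⨅ a ∈ S, (f b a : EReal)) '' G) v ∧
  ∃ b₀ ∈ G, ∃ a₀ ∈ S, IsMinOn (f b₀) S a₀ ∧ (f b₀ a₀ : EReal) = v

end RobustGame

end

/-! The game is solved backwards. Given a continuation value `V`, stage `k` in state `x` is a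
zero-sum game with payoff `M.stageCost k V (x, a) ν`. What is needed is a saddle point `(d x, γ x)`
that depends measurably on `x` and whose value is again an admissible continuation value. The class
that reproduces itself is `IsContinuation`: convex increasing functions bounded by a multiple of one
bounding function `b`.

For such `V` the integrand is convex and lower semicontinuous in `(x, a)`, because the outer
functions are increasing; Fatou's lemma carries semicontinuity through the integral. In `ν` the
payoff is weak* continuous and, the ambiguity sets being convex, affine. Norm bounded weak* closed
ambiguity sets are compact and metrizable (`Mq.compact_metrizable`): this is Banach-Alaoglu, with
limits of pairings represented by `L^q` densities, together with separability of `L^p`. A minimax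
theorem for convex-like functions (`exists_forall_le_of_convexLike`) then yields a saddle point for
each fixed `x`.

The value `m x = min_a max_ν` is a partial minimum of a jointly convex function over a convex set,
hence convex. It is increasing, since costs increase and the action sets shrink with `x`. A finite
convex function on the line is continuous, and continuity of `m` is what gives the sets of optimal
actions and of optimal measures closed lower inverses of closed sets, so that measurable selectors
exist (`BoundedBy.exists_stage_saddle`).

Since the stage operator is monotone in `V`, unilateral deviations that do not pay at any single
stage do not pay over several stages, so the stage saddle points form a Nash equilibrium in rules
that see only the state. Policies that also see the opponent's move add nothing: against a fixed
rule of the opponent they are functions of the state. That nature attains its supremum against every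
controller rule is a separate recursion (`BoundedBy.exists_optimal_reply`), which needs only
measurable continuation values. -/

noncomputable section

namespace RobustGame

/-! ### Measurable selection for compact-valued maps -/

/-- A map with nonempty compact values whose lower inverses of closed sets are measurable. -/
structure MeasurableCompactValued {X Y : Type*} [MeasurableSpace X] [TopologicalSpace Y]
    (Φ : X → Set Y) : Prop where
  isCompact : ∀ x, IsCompact (Φ x)
  nonempty : ∀ x, (Φ x).Nonempty
  measurableSet : ∀ C, IsClosed C → MeasurableSet {x | (Φ x ∩ C).Nonempty}

/-- The points of `Φ x` at which `h` is minimal. -/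
def argminOn {X Y : Type*} (h : Y → ℝ) (Φ : X → Set Y) (x : X) : Set Y :=
  {y ∈ Φ x | ∀ y' ∈ Φ x, h y ≤ h y'}

/-- Minima over compact sets are attained, so some minimizer lies in `C` exactly when every rational
level of `h` reached on `Φ x` is also reached on `Φ x ∩ C`. Only countably many lower inverses of
closed sets are involved. -/
theorem MeasurableCompactValued.argminOn {X Y : Type*} [MeasurableSpace X] [TopologicalSpace Y]
    [T2Space Y] {Φ : X → Set Y} (hΦ : MeasurableCompactValued Φ) {h : Y → ℝ}
    (hh : Continuous h) : MeasurableCompactValued (argminOn h Φ) := by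
  have heq : ∀ x, RobustGame.argminOn h Φ x = Φ x ∩ ⋂ y' ∈ Φ x, {y | h y ≤ h y'} := by
    intro x; ext y; simp [RobustGame.argminOn]
  refine ⟨fun x => ?_, fun x => ?_, fun C hC => ?_⟩
  · rw [heq]
    exact (hΦ.isCompact x).inter_right
      (isClosed_biInter fun y' _ => isClosed_le hh continuous_const)
  · obtain ⟨y, hy, hmin⟩ := (hΦ.isCompact x).exists_isMinOn (hΦ.nonempty x) hh.continuousOn
    exact ⟨y, hy, fun y' hy' => hmin hy'⟩
  · have key : {x | (RobustGame.argminOn h Φ x ∩ C).Nonempty} =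
        ⋂ r : ℚ, ({x | (Φ x ∩ {y | h y ≤ r}).Nonempty}ᶜ ∪
          {x | (Φ x ∩ (C ∩ {y | h y ≤ r})).Nonempty}) := by
      ext x
      simp only [mem_ofPred_eq, mem_iInter, mem_union, mem_compl_iff]
      constructor
      · rintro ⟨y, ⟨hy, hmin⟩, hyC⟩ r
        by_cases hr : (Φ x ∩ {y | h y ≤ r}).Nonempty
        · obtain ⟨y', hy', hr'⟩ := hr
          exact Or.inr ⟨y, hy, hyC, (hmin y' hy').trans hr'⟩
        · exact Or.inl hr
      · intro H
        obtain ⟨y₀, hy₀, hmin₀⟩ :=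
          (hΦ.isCompact x).exists_isMinOn (hΦ.nonempty x) hh.continuousOn
        have H' : ∀ r : ℚ, h y₀ < r → ∃ y ∈ Φ x ∩ C, h y ≤ r := by
          intro r hr
          rcases H r with h1 | ⟨y, hy, hyC, hyr⟩
          · exact absurd ⟨y₀, hy₀, hr.le⟩ h1
          · exact ⟨y, ⟨hy, hyC⟩, hyr⟩
        obtain ⟨r₀, hr₀⟩ := exists_rat_gt (h y₀)
        obtain ⟨y₁, hy₁, -⟩ := H' r₀ hr₀
        obtain ⟨y, hy, hmin⟩ := ((hΦ.isCompact x).inter_right hC).exists_isMinOn ⟨y₁, hy₁⟩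
          hh.continuousOn
        refine ⟨y, ⟨hy.1, fun y' hy' => ?_⟩, hy.2⟩
        by_contra! hlt
        obtain ⟨r, hr1, hr2⟩ := exists_rat_btwn ((hmin₀ hy').trans_lt hlt)
        obtain ⟨y₂, hy₂, hy₂r⟩ := H' r hr1
        exact absurd ((hmin hy₂).trans hy₂r) (not_le.2 hr2)
    rw [key]
    refine MeasurableSet.iInter fun r => ?_
    have hcl : IsClosed {y | h y ≤ (r : ℝ)} := isClosed_le hh continuous_const
    exact (hΦ.measurableSet _ hcl).compl.union (hΦ.measurableSet _ (hC.inter hcl))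

/-- Minimize successively the distances to the points of a dense sequence. The nested compact sets
of minimizers shrink to a single point, because a point is determined by its distances to a dense
sequence. -/
theorem MeasurableCompactValued.exists_selector {X Y : Type*} [MeasurableSpace X] [Nonempty X]
    [TopologicalSpace Y] [TopologicalSpace.MetrizableSpace Y] [SecondCountableTopology Y]
    [MeasurableSpace Y] [BorelSpace Y]
    {Φ : X → Set Y} (hΦ : MeasurableCompactValued Φ) :
    ∃ s : X → Y, Measurable s ∧ ∀ x, s x ∈ Φ x := by
  let := TopologicalSpace.metrizableSpaceMetric Y
  have : Nonempty Y := ⟨(hΦ.nonempty (Classical.arbitrary X)).some⟩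
  let h : ℕ → Y → ℝ := fun j y => dist y (TopologicalSpace.denseSeq Y j)
  have hh : ∀ j, Continuous (h j) := fun j => continuous_id.dist continuous_const
  let Ψ : ℕ → X → Set Y := fun j => Nat.rec Φ (fun j Ψ => RobustGame.argminOn (h j) Ψ) j
  have hΨ : ∀ j, MeasurableCompactValued (Ψ j) := by
    intro j
    induction j with
    | zero => exact hΦ
    | succ j ih => exact ih.argminOn (hh j)
  have hsub : ∀ x j, Ψ (j + 1) x ⊆ Ψ j x := fun x j y hy => hy.1
  have hne : ∀ C, IsClosed C → ∀ x, (∀ j, (Ψ j x ∩ C).Nonempty) →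
      (⋂ j, Ψ j x ∩ C).Nonempty := fun C hC x hx =>
    IsCompact.nonempty_iInter_of_sequence_nonempty_isCompact_isClosed _
      (fun j => inter_subset_inter_left _ (hsub x j)) hx
      (((hΨ 0).isCompact x).inter_right hC)
      (fun j => ((hΨ j).isCompact x).isClosed.inter hC)
  have huniq : ∀ x y y', (∀ j, y ∈ Ψ j x) → (∀ j, y' ∈ Ψ j x) → y = y' := by
    intro x y y' hy hy'
    have hd : ∀ j, h j y = h j y' := fun j =>
      le_antisymm ((hy (j + 1)).2 y' (hy' j)) ((hy' (j + 1)).2 y (hy j))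
    have hfun : (fun u => dist y u) = fun u => dist y' u :=
      Continuous.ext_on (TopologicalSpace.denseRange_denseSeq Y) (by fun_prop) (by fun_prop)
        (by rintro _ ⟨j, rfl⟩; exact hd j)
    have := congrFun hfun y'
    simpa using this
  have hex : ∀ x, ∃ y, ∀ j, y ∈ Ψ j x := by
    intro x
    obtain ⟨y, hy⟩ := hne univ isClosed_univ x fun j => by simpa using (hΨ j).nonempty x
    exact ⟨y, fun j => (mem_iInter.1 hy j).1⟩
  choose s hs using hex
  refine ⟨s, measurable_of_isClosed fun C hC => ?_, fun x => hs x 0⟩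
  -- By compactness the nested intersection meets `C` as soon as every `Ψ j x` does, and its only
  -- point is `s x`.
  have : s ⁻¹' C = ⋂ j, {x | (Ψ j x ∩ C).Nonempty} := by
    ext x
    simp only [mem_preimage, mem_iInter, mem_ofPred_eq]
    constructor
    · exact fun hx j => ⟨s x, hs x j, hx⟩
    · intro hx
      obtain ⟨y, hy⟩ := hne C hC x hx
      have h1 := fun j => (mem_iInter.1 hy j)
      rw [huniq x (s x) y (hs x) fun j => (h1 j).1]
      exact (h1 0).2
  rw [this]
  exact MeasurableSet.iInter fun j => (hΨ j).measurableSet C hC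

/-- Measurable maximizers of a function that is measurable in `x` and continuous on a compact
metrizable space in `y`. -/
theorem exists_measurable_argmax {X Y : Type*} [MeasurableSpace X] [Nonempty X]
    [TopologicalSpace Y] [TopologicalSpace.MetrizableSpace Y] [SecondCountableTopology Y]
    [CompactSpace Y] [Nonempty Y] [MeasurableSpace Y] [BorelSpace Y] {f : X → Y → ℝ}
    (hf : ∀ y, Measurable fun x => f x y) (hc : ∀ x, Continuous (f x)) :
    ∃ s : X → Y, Measurable s ∧ ∀ x y, f x y ≤ f x (s x) := by
  have hΦ : MeasurableCompactValued fun x => {y | ∀ y', f x y' ≤ f x y} := by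
    have hcl : ∀ x, IsClosed {y | ∀ y', f x y' ≤ f x y} := fun x => by
      simp only [ofPred_forall]
      exact isClosed_iInter fun y' => isClosed_le continuous_const (hc x)
    refine ⟨fun x => (hcl x).isCompact, fun x => ?_, fun C hC => ?_⟩
    · obtain ⟨y, -, hy⟩ := isCompact_univ.exists_isMaxOn univ_nonempty (hc x).continuousOn
      exact ⟨y, fun y' => hy (mem_univ y')⟩
    · rcases C.eq_empty_or_nonempty with rfl | hCne
      · simp
      have : Nonempty C := hCne.to_subtype
      let u := TopologicalSpace.denseSeq Y
      let v : ℕ → C := TopologicalSpace.denseSeq C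
      -- A maximizer lies in `C` iff no rational level is exceeded on `Y` but not on `C`. By
      -- continuity this can be tested along dense sequences of `Y` and of `C`.
      have key : {x | ({y | ∀ y', f x y' ≤ f x y} ∩ C).Nonempty} =
          ⋂ i, ⋂ r : ℚ, ({x | f x (u i) ≤ r} ∪ ⋃ j, {x | (r : ℝ) < f x (v j)}) := by
        ext x
        simp only [mem_ofPred_eq, mem_iInter, mem_union, mem_iUnion]
        constructor
        · rintro ⟨y, hy, hyC⟩ i r
          by_cases hr : f x (u i) ≤ r
          · exact Or.inl hr
          right
          have hlt : (r : ℝ) < f x y := (not_le.1 hr).trans_le (hy _)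
          have hopen : IsOpen {w : C | (r : ℝ) < f x w} :=
            isOpen_lt continuous_const ((hc x).comp continuous_subtype_val)
          obtain ⟨_, hw, j, rfl⟩ :=
            (TopologicalSpace.denseRange_denseSeq C).inter_open_nonempty _ hopen ⟨⟨y, hyC⟩, hlt⟩
          exact ⟨j, hw⟩
        · intro H
          obtain ⟨y, hyC, hy⟩ := hC.isCompact.exists_isMaxOn hCne (hc x).continuousOn
          refine ⟨y, fun y' => ?_, hyC⟩
          have hle : ∀ i, f x (u i) ≤ f x y := by
            intro i
            by_contra! hlt
            obtain ⟨r, hr1, hr2⟩ := exists_rat_btwn hlt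
            rcases H i r with h1 | ⟨j, hj⟩
            · exact absurd h1 (not_le.2 hr2)
            · exact absurd (hj.trans_le (hy (v j).2)) (not_lt.2 hr1.le)
          have hcl : IsClosed {w | f x w ≤ f x y} := isClosed_le (hc x) continuous_const
          exact hcl.closure_subset_iff.2 (by rintro _ ⟨i, rfl⟩; exact hle i)
            (TopologicalSpace.denseRange_denseSeq Y y')
      rw [key]
      refine MeasurableSet.iInter fun i => MeasurableSet.iInter fun r =>
        (measurableSet_le (hf _) measurable_const).union (MeasurableSet.iUnion fun j =>
          measurableSet_lt measurable_const (hf _))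
  obtain ⟨s, hs, hs'⟩ := hΦ.exists_selector
  exact ⟨s, hs, fun x y => hs' x y⟩

/-! ### A minimax theorem -/

/-- Finite form: if some `f x (e i)` exceeds `c` for every `x ∈ S`, then a convex combination
of the functions `f · (e i)` is at least `c` on `S`. -/
theorem exists_weights_of_convexLike {X I : Type*} [Fintype I] {S : Set X}
    (hS : S.Nonempty) {f : X → I → ℝ} {c : ℝ}
    (hconv : ∀ u ∈ S, ∀ v ∈ S, ∀ s t : ℝ, 0 ≤ s → 0 ≤ t → s + t = 1 →
      ∃ w ∈ S, ∀ i, f w i ≤ s * f u i + t * f v i)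
    (hc : ∀ x ∈ S, ∃ i, c < f x i) :
    ∃ w : I → ℝ, (∀ i, 0 ≤ w i) ∧ ∑ i, w i = 1 ∧ ∀ x ∈ S, c ≤ ∑ i, w i * f x i := by
  classical
  -- Separate the open orthant below the constant vector `c` from the set of vectors dominating some
  -- `f x`; the normal of the hyperplane, rescaled, gives the weights.
  let U : Set (I → ℝ) := {u | ∀ i, u i < c}
  let W : Set (I → ℝ) := {u | ∃ x ∈ S, ∀ i, f x i ≤ u i}
  have hUo : IsOpen U := by
    simp only [U, ofPred_forall]
    exact isOpen_iInter_of_finite fun i => isOpen_lt (continuous_apply i) continuous_const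
  have hUc : Convex ℝ U := by
    intro u hu v hv s t hs ht hst i
    have : s * u i + t * v i < c := by
      have h1 := hu i; have h2 := hv i
      rcases hs.eq_or_lt with rfl | hs'
      · obtain rfl : t = 1 := by linarith
        linarith
      · have h3 : c = s * c + t * c := by rw [← add_mul, hst, one_mul]
        have h4 := mul_lt_mul_of_pos_left h1 hs'
        have h5 := mul_le_mul_of_nonneg_left h2.le ht
        linarith
    simpa using this
  have hWc : Convex ℝ W := by
    rintro u ⟨x, hx, hxu⟩ v ⟨y, hy, hyv⟩ s t hs ht hst
    obtain ⟨w, hw, hw'⟩ := hconv x hx y hy s t hs ht hst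
    refine ⟨w, hw, fun i => (hw' i).trans ?_⟩
    have := add_le_add (mul_le_mul_of_nonneg_left (hxu i) hs)
      (mul_le_mul_of_nonneg_left (hyv i) ht)
    simpa using this
  have hdisj : Disjoint U W := by
    rw [Set.disjoint_left]
    rintro u hu ⟨x, hx, hxu⟩
    obtain ⟨i, hi⟩ := hc x hx
    exact absurd (hi.trans_le (hxu i)) (not_lt.2 (hu i).le)
  obtain ⟨φ, r, hφU, hφW⟩ := geometric_hahn_banach_open hUc hUo hWc hdisj
  let l : I → ℝ := fun i => φ (Pi.single i 1)
  have hφ : ∀ u : I → ℝ, φ u = ∑ i, l i * u i := by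
    intro u
    have : u = ∑ i, u i • (Pi.single i 1 : I → ℝ) := by
      ext j; simp [Finset.sum_apply, Pi.single_apply]
    conv_lhs => rw [this]
    simp [l, mul_comm]
  obtain ⟨x₀, hx₀⟩ := hS
  -- `W` is upward closed, so a negative coefficient would make `φ` unbounded below on it.
  have hl : ∀ i, 0 ≤ l i := by
    intro i
    by_contra! hneg
    have hlow : ∀ t : ℝ, 0 ≤ t → r ≤ φ (f x₀) + t * l i := by
      intro t ht
      have hmem : f x₀ + t • (Pi.single i 1 : I → ℝ) ∈ W := by
        refine ⟨x₀, hx₀, fun j => ?_⟩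
        have : 0 ≤ t * (Pi.single i 1 : I → ℝ) j :=
          mul_nonneg ht (by by_cases h : j = i <;> simp [h])
        simpa using this
      simpa [l] using hφW _ hmem
    have hp : (0 : ℝ) ≤ (|r - φ (f x₀)| + 1) / (-l i) := by
      have : 0 < -l i := by linarith
      positivity
    have h1 := hlow _ hp
    have h2 : (|r - φ (f x₀)| + 1) / (-l i) * l i = -(|r - φ (f x₀)| + 1) := by
      have : l i ≠ 0 := hneg.ne
      field_simp
    rw [h2] at h1
    have := neg_abs_le (r - φ (f x₀))
    linarith
  -- The constant vector `c` is only a boundary point of `U`, so it is approached from below. The `+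
  -- 1` in the denominator avoids division by zero before the total weight is known to be positive.
  have hle : c * ∑ i, l i ≤ r := by
    refine le_of_forall_pos_lt_add fun ε hε => ?_
    have hL : 0 ≤ ∑ i, l i := Finset.sum_nonneg fun i _ => hl i
    have h1 := hφU (fun _ => c - ε / (∑ i, l i + 1)) (fun i => by
      have : 0 < ε / (∑ i, l i + 1) := by positivity
      linarith)
    rw [hφ, ← Finset.sum_mul] at h1
    have h2 : (∑ i, l i) * (ε / (∑ i, l i + 1)) ≤ ε := by
      rw [mul_div_assoc', div_le_iff₀ (by positivity)]
      nlinarith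
    nlinarith
  have hpos : 0 < ∑ i, l i := by
    refine lt_of_le_of_ne (Finset.sum_nonneg fun i _ => hl i) fun h0 => ?_
    have hz : ∀ i, l i = 0 := fun i =>
      (Finset.sum_eq_zero_iff_of_nonneg fun i _ => hl i).1 h0.symm i (Finset.mem_univ i)
    have h1 := hφU (fun _ => c - 1) (fun i => by linarith)
    have h2 := hφW (f x₀) ⟨x₀, hx₀, fun i => le_rfl⟩
    rw [hφ] at h1 h2
    simp [hz] at h1 h2
    linarith
  refine ⟨fun i => l i / ∑ j, l j, fun i => div_nonneg (hl i) hpos.le, ?_, fun x hx => ?_⟩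
  · rw [← Finset.sum_div, div_self hpos.ne']
  · have h1 := hφW (f x) ⟨x, hx, fun i => le_rfl⟩
    rw [hφ] at h1
    have : ∑ i, l i / (∑ j, l j) * f x i = (∑ i, l i * f x i) / ∑ j, l j := by
      rw [Finset.sum_div]; exact Finset.sum_congr rfl fun i _ => by ring
    rw [this, le_div_iff₀ hpos]
    exact hle.trans h1

/-- Lower semicontinuity and compactness reduce the strict inequality to finitely many `ν i`. The
finite form produces weights for these, and concavity in the second variable replaces the weighted
average by a single `ν`. -/
theorem exists_forall_le_of_convexLike {X Q : Type*} [TopologicalSpace X] {S : Set X}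
    (hS : IsCompact S) (hne : S.Nonempty) {f : X → Q → ℝ} {c : ℝ}
    (hlsc : ∀ ν, LowerSemicontinuousOn (fun x => f x ν) S)
    (hconv : ∀ u ∈ S, ∀ v ∈ S, ∀ s t : ℝ, 0 ≤ s → 0 ≤ t → s + t = 1 →
      ∃ w ∈ S, ∀ ν, f w ν ≤ s * f u ν + t * f v ν)
    (hconc : ∀ μ ν, ∀ s t : ℝ, 0 ≤ s → 0 ≤ t → s + t = 1 →
      ∃ κ, ∀ x ∈ S, s * f x μ + t * f x ν ≤ f x κ)
    (hc : ∀ x ∈ S, ∃ ν, c < f x ν) :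
    ∃ ν, ∀ x ∈ S, c ≤ f x ν := by
  have : Nonempty Q := ⟨(hc _ hne.some_mem).choose⟩
  have hcov : ∀ x ∈ S, ∃ U ∈ 𝓝[S] x, ∃ ν, ∀ y ∈ U, c < f y ν := fun x hx => by
    obtain ⟨ν, hν⟩ := hc x hx
    exact ⟨_, hlsc ν x hx c hν, ν, fun y hy => hy⟩
  choose! U hU ν hν using hcov
  obtain ⟨I, hIS, hI⟩ := hS.elim_nhdsWithin_subcover U hU
  obtain ⟨w, hw0, hw1, hw⟩ := exists_weights_of_convexLike (I := I) hne
    (f := fun x i => f x (ν i)) (c := c)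
    (fun u hu v hv s t hs ht hst => by
      obtain ⟨w, hw, hw'⟩ := hconv u hu v hv s t hs ht hst
      exact ⟨w, hw, fun i => hw' _⟩)
    (fun x hx => by
      obtain ⟨i, hi, hxi⟩ := mem_iUnion₂.1 (hI hx)
      exact ⟨⟨i, hi⟩, hν i (hIS i hi) x hxi⟩)
  -- Convexity of the set of functions dominated on `S` by some `f · κ` extends the two-point mixing
  -- hypothesis to finite mixtures.
  have hG : Convex ℝ {g : X → ℝ | ∃ κ, ∀ x ∈ S, g x ≤ f x κ} := by
    rintro g ⟨κ, hκ⟩ g' ⟨κ', hκ'⟩ s t hs ht hst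
    obtain ⟨κ'', h⟩ := hconc κ κ' s t hs ht hst
    refine ⟨κ'', fun x hx => le_trans ?_ (h x hx)⟩
    have := add_le_add (mul_le_mul_of_nonneg_left (hκ x hx) hs)
      (mul_le_mul_of_nonneg_left (hκ' x hx) ht)
    simpa using this
  obtain ⟨κ, hκ⟩ := hG.sum_mem (t := (Finset.univ : Finset I)) (fun i _ => hw0 i) hw1
    (z := fun (i : I) x => f x (ν i)) (fun i _ => ⟨ν i, fun x _ => le_rfl⟩)
  refine ⟨κ, fun x hx => (hw x hx).trans ?_⟩
  simpa [Finset.sum_apply] using hκ x hx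

/-! ### Lower semicontinuity of integrals -/

/-- Fatou's lemma for the nonnegative functions `h y + Θ`. First countability provides a sequence
violating semicontinuity, to which Fatou applies. -/
theorem lowerSemicontinuousWithinAt_integral {Y Z : Type*} [TopologicalSpace Y]
    [FirstCountableTopology Y] [MeasurableSpace Z] {μ : Measure Z} {D : Set Y} {y₀ : Y}
    {h : Y → Z → ℝ} {Θ : Z → ℝ} (hy₀ : y₀ ∈ D) (hΘ : Integrable Θ μ)
    (hm : ∀ y ∈ D, AEStronglyMeasurable (h y) μ)
    (hb : ∀ᶠ y in 𝓝[D] y₀, ∀ z, |h y z| ≤ Θ z)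
    (hlsc : ∀ z, LowerSemicontinuousWithinAt (fun y => h y z) D y₀) :
    LowerSemicontinuousWithinAt (fun y => ∫ z, h y z ∂μ) D y₀ := by
  intro t ht
  by_contra hcon
  have hfr : ∃ᶠ y in 𝓝[D] y₀, (∫ z, h y z ∂μ ≤ t ∧ y ∈ D) ∧ ∀ z, |h y z| ≤ Θ z := by
    have h1 : ∃ᶠ y in 𝓝[D] y₀, ∫ z, h y z ∂μ ≤ t := fun h' =>
      hcon (h'.mono fun y hy => not_le.1 hy)
    exact (h1.and_eventually self_mem_nhdsWithin).and_eventually hb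
  obtain ⟨y, hy, hyP⟩ := exists_seq_forall_of_frequently hfr
  have hb₀ : ∀ z, |h y₀ z| ≤ Θ z := hb.self_of_nhdsWithin hy₀
  have hint : ∀ y' ∈ D, (∀ z, |h y' z| ≤ Θ z) → Integrable (fun z => h y' z + Θ z) μ :=
    fun y' hy' hb' => (Integrable.mono' hΘ (hm y' hy')
      (Eventually.of_forall fun z => hb' z)).add hΘ
  have hnn : ∀ y', (∀ z, |h y' z| ≤ Θ z) → ∀ z, 0 ≤ h y' z + Θ z := fun y' hb' z => by
    linarith [neg_abs_le (h y' z), hb' z]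
  have hfat : ∫⁻ z, ENNReal.ofReal (h y₀ z + Θ z) ∂μ ≤
      ENNReal.ofReal (t + ∫ z, Θ z ∂μ) := by
    calc ∫⁻ z, ENNReal.ofReal (h y₀ z + Θ z) ∂μ
        ≤ ∫⁻ z, liminf (fun j => ENNReal.ofReal (h (y j) z + Θ z)) atTop ∂μ := by
          refine lintegral_mono fun z => ?_
          refine le_of_forall_lt fun a ha => ?_
          obtain ⟨b, hab, hb1⟩ := exists_between ha
          refine hab.trans_le (le_liminf_of_le (by isBoundedDefault) ?_)
          have hbtop : b ≠ ∞ := ne_top_of_lt hb1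
          have h2 : b.toReal - Θ z < h y₀ z := by
            have := (ENNReal.lt_ofReal_iff_toReal_lt hbtop).1 hb1
            linarith
          filter_upwards [hy.eventually (hlsc z _ h2)] with j hj
          rw [ENNReal.le_ofReal_iff_toReal_le hbtop (hnn _ (hyP j).2 z)]
          linarith
      _ ≤ liminf (fun j => ∫⁻ z, ENNReal.ofReal (h (y j) z + Θ z) ∂μ) atTop :=
          lintegral_liminf_le' fun j =>
            (hint _ (hyP j).1.2 (hyP j).2).aestronglyMeasurable.aemeasurable.ennreal_ofReal
      _ ≤ ENNReal.ofReal (t + ∫ z, Θ z ∂μ) := by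
          refine liminf_le_of_le (by isBoundedDefault) fun b hb => ?_
          obtain ⟨j, hj⟩ := hb.exists
          refine hj.trans ?_
          rw [← ofReal_integral_eq_lintegral_ofReal (hint _ (hyP j).1.2 (hyP j).2)
            (Eventually.of_forall (hnn _ (hyP j).2))]
          refine ENNReal.ofReal_le_ofReal ?_
          have h3 : Integrable (h (y j)) μ := Integrable.mono' hΘ (hm _ (hyP j).1.2)
            (Eventually.of_forall fun z => (hyP j).2 z)
          rw [integral_add h3 hΘ]
          linarith [(hyP j).1.1]
  have h3 : Integrable (h y₀) μ := Integrable.mono' hΘ (hm _ hy₀)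
    (Eventually.of_forall fun z => hb₀ z)
  rw [← ofReal_integral_eq_lintegral_ofReal (hint _ hy₀ hb₀) (Eventually.of_forall (hnn _ hb₀)),
    integral_add h3 hΘ] at hfat
  -- Comparing the two `ENNReal.ofReal` terms yields the real inequality only if the right one is
  -- not truncated at zero.
  have h6 : 0 ≤ t + ∫ z, Θ z ∂μ := by
    have : -∫ z, Θ z ∂μ ≤ ∫ z, h (y 0) z ∂μ := by
      rw [← integral_neg]
      refine integral_mono hΘ.neg (Integrable.mono' hΘ (hm _ (hyP 0).1.2)
        (Eventually.of_forall fun z => (hyP 0).2 z)) fun z => ?_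
      simpa using neg_le_of_abs_le ((hyP 0).2 z)
    linarith [(hyP 0).1.1]
  rw [ENNReal.ofReal_le_ofReal_iff h6] at hfat
  linarith

/-! ### Positive functionals on `L^p` -/

section Duality

variable {Z : Type*} [MeasurableSpace Z] {μ : Measure Z} [IsFiniteMeasure μ] {p q : ℝ≥0∞}

/-- The measure `s ↦ φ 1_s` of a positive functional `φ` on `L^p`. -/
theorem exists_measure_of_positive [Fact (1 ≤ p)] (hp : p ≠ ∞) (φ : Lp ℝ p μ →L[ℝ] ℝ)
    (hφ : ∀ s (hs : MeasurableSet s), 0 ≤ φ (indicatorConstLp p hs (measure_ne_top μ s) 1)) :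
    ∃ ν : Measure Z, IsFiniteMeasure ν ∧ ν ≪ μ ∧ ∀ s (hs : MeasurableSet s),
      ν.real s = φ (indicatorConstLp p hs (measure_ne_top μ s) 1) := by
  let m : ∀ s : Set Z, MeasurableSet s → ℝ≥0∞ := fun s hs =>
    ENNReal.ofReal (φ (indicatorConstLp p hs (measure_ne_top μ s) 1))
  have m0 : m ∅ MeasurableSet.empty = 0 := by simp [m]
  have hfin : ∀ (f : ℕ → Set Z) (hf : ∀ i, MeasurableSet (f i)), Pairwise (Function.onFun Disjoint f) →
      ∀ n, φ (indicatorConstLp p (MeasurableSet.biUnion (Finset.range n).countable_toSet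
        fun i _ => hf i) (measure_ne_top μ _) 1) =
        ∑ i ∈ Finset.range n, φ (indicatorConstLp p (hf i) (measure_ne_top μ _) 1) := by
    intro f hf hd n
    induction n with
    | zero => simp
    | succ n ih =>
      rw [Finset.sum_range_succ, ← ih, ← map_add, ← indicatorConstLp_disjoint_union]
      · congr 2
        ext z
        simp only [Finset.coe_range, mem_Iio, mem_iUnion, mem_union, exists_prop,
          Nat.lt_succ_iff_lt_or_eq, or_and_right, exists_or, exists_eq_left]
      · simp only [disjoint_iUnion_left, Finset.coe_range, mem_Iio]
        exact fun i hi => hd (ne_of_lt hi)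
  have mU : ∀ ⦃f : ℕ → Set Z⦄ (hf : ∀ i, MeasurableSet (f i)), Pairwise (Function.onFun Disjoint f) →
      m (⋃ i, f i) (MeasurableSet.iUnion hf) = ∑' i, m (f i) (hf i) := by
    intro f hf hd
    -- Finite additivity passes to the limit because the indicators of the partial unions converge
    -- in `L^p`; this uses `p ≠ ∞`.
    have hsum : HasSum (fun i => φ (indicatorConstLp p (hf i) (measure_ne_top μ _) 1))
        (φ (indicatorConstLp p (MeasurableSet.iUnion hf) (measure_ne_top μ _) 1)) := by
      rw [hasSum_iff_tendsto_nat_of_nonneg fun i => hφ _ _]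
      simp only [← hfin f hf hd]
      refine (φ.continuous.tendsto _).comp (tendsto_indicatorConstLp_set hp ?_)
      have hsub : ∀ n, (⋃ i ∈ (Finset.range n : Set ℕ), f i) ⊆ ⋃ i, f i := fun n =>
        iUnion₂_subset fun i _ => subset_iUnion f i
      have heq : ∀ n, symmDiff (⋃ i ∈ (Finset.range n : Set ℕ), f i) (⋃ i, f i) =
          (⋃ i, f i) \ ⋃ i ∈ (Finset.range n : Set ℕ), f i := fun n => by
        rw [symmDiff_of_le (hsub n)]
      simp only [heq]
      have hT := tendsto_measure_iInter_atTop (μ := μ)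
        (s := fun n => (⋃ i, f i) \ ⋃ i ∈ (Finset.range n : Set ℕ), f i)
        (fun n => ((MeasurableSet.iUnion hf).diff (MeasurableSet.biUnion
          (Finset.range n).countable_toSet fun i _ => hf i)).nullMeasurableSet)
        (fun a b hab => sdiff_subset_sdiff_right (biUnion_subset_biUnion_left
          (by simpa using hab)))
        ⟨0, measure_ne_top μ _⟩
      have hem : ⋂ n, (⋃ i, f i) \ ⋃ i ∈ (Finset.range n : Set ℕ), f i = ∅ := by
        rw [eq_empty_iff_forall_notMem]
        intro z hz
        obtain ⟨i, hi⟩ := mem_iUnion.1 (mem_iInter.1 hz 0).1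
        exact (mem_iInter.1 hz (i + 1)).2 (mem_iUnion₂.2 ⟨i, by simp, hi⟩)
      rw [hem, measure_empty] at hT
      exact hT
    simp only [m]
    rw [← ENNReal.ofReal_tsum_of_nonneg (fun i => hφ _ _) hsum.summable, hsum.tsum_eq]
  have happ : ∀ s (hs : MeasurableSet s), Measure.ofMeasurable m m0 mU s = m s hs := fun s hs =>
    Measure.ofMeasurable_apply s hs
  refine ⟨Measure.ofMeasurable m m0 mU, ⟨?_⟩, ?_, fun s hs => ?_⟩
  · rw [happ _ MeasurableSet.univ]
    exact ENNReal.ofReal_lt_top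
  · refine Measure.AbsolutelyContinuous.mk fun s hs h0 => ?_
    rw [happ s hs]
    have hz : indicatorConstLp p hs (measure_ne_top μ s) (1 : ℝ) = 0 := by
      rw [← indicatorConstLp_empty (c := (1 : ℝ)), indicatorConstLp_inj _ _ _ _ one_ne_zero]
      exact ae_eq_empty.2 h0
    simp [m, hz]
  · rw [Measure.real, happ s hs, ENNReal.toReal_ofReal (hφ s hs)]

theorem map_toLp_simpleFunc [Fact (1 ≤ p)] {φ : Lp ℝ p μ →L[ℝ] ℝ} {ν : Measure Z}
    [IsFiniteMeasure ν]
    (hν : ∀ s (hs : MeasurableSet s),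
      ν.real s = φ (indicatorConstLp p hs (measure_ne_top μ s) 1)) (f : SimpleFunc Z ℝ) :
    φ ((f.memLp_of_isFiniteMeasure p μ).toLp) = ∫ z, f z ∂ν := by
  induction f using SimpleFunc.induction with
  | @const c s hs =>
    have h1 : ((SimpleFunc.piecewise s hs (SimpleFunc.const Z c)
        (SimpleFunc.const Z 0)).memLp_of_isFiniteMeasure p μ).toLp =
        c • indicatorConstLp p hs (measure_ne_top μ s) (1 : ℝ) := by
      rw [indicatorConstLp, ← MemLp.toLp_const_smul]
      refine MemLp.toLp_congr _ _ (Eventually.of_forall fun z => ?_)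
      by_cases hz : z ∈ s <;> simp [hz]
    rw [h1, map_smul, ← hν]
    have h2 : (fun z => SimpleFunc.piecewise s hs (SimpleFunc.const Z c)
        (SimpleFunc.const Z 0) z) = s.indicator fun _ => c := by
      ext z; by_cases hz : z ∈ s <;> simp [hz]
    rw [h2, integral_indicator_const _ hs]
    simp [mul_comm]
  | @add f g hfg hf hg =>
    have : ((f + g).memLp_of_isFiniteMeasure p μ).toLp =
        (f.memLp_of_isFiniteMeasure p μ).toLp + (g.memLp_of_isFiniteMeasure p μ).toLp :=
      MemLp.toLp_add _ _
    rw [this, map_add, hf, hg, ← integral_add (f.integrable_of_isFiniteMeasure)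
      (g.integrable_of_isFiniteMeasure)]
    rfl

/-- A converse to Hölder's inequality, tested on simple functions. -/
theorem lintegral_rpow_le_of_forall_simpleFunc {F : Z → ℝ≥0∞} (hF : Measurable F) {p q : ℝ}
    (hpq : p.HolderConjugate q) {K : ℝ≥0∞}
    (h : ∀ s : SimpleFunc Z NNReal, ∫⁻ z, F z * s z ∂μ ≤ K * (∫⁻ z, (s z : ℝ≥0∞) ^ p ∂μ) ^ (1 / p)) :
    ∫⁻ z, F z ^ q ∂μ ≤ K ^ q := by
  have hq := hpq.symm.lt
  have hq0 : 0 < q := hpq.symm.pos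
  have happ : ∀ n, ∫⁻ z, (SimpleFunc.eapprox F n z) ^ q ∂μ ≤ K ^ q := by
    intro n
    let e := SimpleFunc.eapprox F n
    -- The test function `e ^ (q - 1)` is the equality case of Hölder's inequality.
    let s : SimpleFunc Z NNReal := e.map fun t => t.toNNReal ^ (q - 1)
    have hs : ∀ z, (s z : ℝ≥0∞) = e z ^ (q - 1) := fun z => by
      have : e z ≠ ∞ := (SimpleFunc.eapprox_lt_top F n z).ne
      simp only [s, SimpleFunc.map_apply]
      rw [ENNReal.coe_rpow_of_nonneg _ (by linarith), ENNReal.coe_toNNReal this]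
    have hle : ∀ z, e z ≤ F z := fun z => by
      rw [← SimpleFunc.iSup_eapprox_apply hF z]
      exact le_iSup (fun n => SimpleFunc.eapprox F n z) n
    have h1 := h s
    have h2 : ∀ z, (s z : ℝ≥0∞) ^ p = e z ^ q := fun z => by
      rw [hs, ← ENNReal.rpow_mul, hpq.symm.sub_one_mul_conj]
    have h3 : ∀ z, e z ^ q = e z * s z := fun z => by
      rw [hs]
      rcases eq_or_ne (e z) 0 with h0 | h0
      · simp [h0, hq0]
      · conv_rhs => rw [← ENNReal.rpow_one (e z), ← ENNReal.rpow_mul, ← ENNReal.rpow_add _ _ h0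
          (SimpleFunc.eapprox_lt_top F n z).ne]
        congr 1; ring
    simp only [h2] at h1
    have h4 : ∫⁻ z, e z ^ q ∂μ ≤ K * (∫⁻ z, e z ^ q ∂μ) ^ (1 / p) := by
      refine le_trans (lintegral_mono fun z => ?_) h1
      rw [h3]
      exact mul_le_mul_left (hle z) _
    -- Finiteness, guaranteed by the simple truncation of `F`, is what permits cancelling a power of
    -- the integral.
    have hfin : ∫⁻ z, e z ^ q ∂μ ≠ ∞ := by
      have h5 : ∫⁻ z, (e.map fun t => t ^ q) z ∂μ < ∞ := by
        rw [SimpleFunc.lintegral_eq_lintegral]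
        refine (SimpleFunc.finMeasSupp_iff.2 fun _ _ => measure_lt_top _ _).lintegral_lt_top
          (Eventually.of_forall fun z => ?_)
        exact (ENNReal.rpow_lt_top_of_nonneg hq0.le (SimpleFunc.eapprox_lt_top F n z).ne).ne
      simpa using h5.ne
    rcases eq_or_ne (∫⁻ z, e z ^ q ∂μ) 0 with h0 | h0
    · rw [show (∫⁻ z, (SimpleFunc.eapprox F n z) ^ q ∂μ) = 0 from h0]; exact zero_le
    · have h6 : (∫⁻ z, e z ^ q ∂μ) ^ (1 / q) ≤ K := by
        have h7 : (1 : ℝ) / q = 1 - 1 / p := by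
          have := hpq.inv_add_inv_eq_one
          simp only [one_div]; linarith
        rw [h7, ENNReal.rpow_sub _ _ h0 hfin, ENNReal.rpow_one]
        exact ENNReal.div_le_of_le_mul h4
      have h8 := ENNReal.rpow_le_rpow h6 hq0.le
      rwa [← ENNReal.rpow_mul, one_div, inv_mul_cancel₀ hq0.ne', ENNReal.rpow_one] at h8
  have hlim : ∫⁻ z, F z ^ q ∂μ = ⨆ n, ∫⁻ z, (SimpleFunc.eapprox F n z) ^ q ∂μ := by
    rw [← lintegral_iSup]
    · refine lintegral_congr fun z => ?_
      rw [← SimpleFunc.iSup_eapprox_apply hF z]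
      exact (ENNReal.orderIsoRpow q hq0).map_iSup _
    · exact fun n => (SimpleFunc.eapprox F n).measurable.pow_const q
    · exact fun a b hab z => ENNReal.rpow_le_rpow (SimpleFunc.monotone_eapprox F hab z) hq0.le
  rw [hlim]
  exact iSup_le happ

/-- Positive functionals on `L^p` are represented by elements of `L^q`. -/
theorem exists_Lp_representation [Fact (1 ≤ p)] [Fact (1 ≤ q)] [p.HolderConjugate q] (hp : p ≠ ∞)
    (φ : Lp ℝ p μ →L[ℝ] ℝ)
    (hφ : ∀ s (hs : MeasurableSet s), 0 ≤ φ (indicatorConstLp p hs (measure_ne_top μ s) 1)) :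
    ∃ f : Lp ℝ q μ, ∀ g : Lp ℝ p μ, ∫ z, f z * g z ∂μ = φ g := by
  obtain ⟨ν, hνfin, hac, hν⟩ := exists_measure_of_positive hp φ hφ
  let F := ν.rnDeriv μ
  have hFm : Measurable F := Measure.measurable_rnDeriv _ _
  -- On simple functions, integrating against `F` is applying `φ`, so the operator norm bounds the
  -- pairing by the `L^p` norm.
  have hbd : ∀ s : SimpleFunc Z NNReal, ∫⁻ z, F z * s z ∂μ ≤
      ENNReal.ofReal ‖φ‖ * eLpNorm (fun z => (s z : ℝ)) p μ := by
    intro s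
    let s' : SimpleFunc Z ℝ := s.map (fun t : NNReal => (t : ℝ))
    have h1 : ∫⁻ z, F z * s z ∂μ = ENNReal.ofReal (∫ z, s' z ∂ν) := by
      rw [lintegral_rnDeriv_mul hac (by fun_prop),
        ofReal_integral_eq_lintegral_ofReal s'.integrable_of_isFiniteMeasure
          (Eventually.of_forall fun z => by simp [s'])]
      simp [s']
    rw [h1, ← map_toLp_simpleFunc hν s']
    have h2 := (le_abs_self _).trans (φ.le_opNorm (s'.memLp_of_isFiniteMeasure p μ).toLp)
    refine (ENNReal.ofReal_le_ofReal h2).trans ?_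
    rw [ENNReal.ofReal_mul (norm_nonneg _), Lp.norm_toLp,
      ENNReal.ofReal_toReal (s'.memLp_of_isFiniteMeasure p μ).eLpNorm_ne_top]
    rfl
  have hFe : ∀ z, ‖(F z).toReal‖ₑ ≤ F z := fun z => by
    rw [Real.enorm_eq_ofReal ENNReal.toReal_nonneg]
    exact ENNReal.ofReal_toReal_le
  have hmem : MemLp (fun z => (F z).toReal) q μ := by
    have hsm : AEStronglyMeasurable (fun z => (F z).toReal) μ :=
      hFm.ennreal_toReal.aestronglyMeasurable
    have hp0 : p ≠ 0 := (zero_lt_one.trans_le (Fact.out : 1 ≤ p)).ne'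
    have hq0 : q ≠ 0 := (zero_lt_one.trans_le (Fact.out : 1 ≤ q)).ne'
    -- For `q = ∞` testing on indicators bounds `F` almost everywhere by `‖φ‖`; for finite `q` the
    -- converse of Hölder's inequality applies.
    rcases eq_or_ne q ∞ with rfl | hq
    · have hp1 : p = 1 := by
        have := ENNReal.HolderConjugate.inv_add_inv_eq_one p ∞
        simpa using this
      subst hp1
      have hle : F ≤ᵐ[μ] fun _ => ENNReal.ofReal ‖φ‖ := by
        refine ae_le_of_forall_setLIntegral_le_of_sigmaFinite hFm fun s hs _ => ?_
        have h1 := hbd (SimpleFunc.piecewise s hs (SimpleFunc.const Z 1) (SimpleFunc.const Z 0))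
        have h2 : ∀ z, F z * ((SimpleFunc.piecewise s hs (SimpleFunc.const Z 1)
            (SimpleFunc.const Z 0)) z : NNReal) = s.indicator F z := fun z => by
          by_cases hz : z ∈ s <;> simp [hz]
        have h3 : (fun z => (((SimpleFunc.piecewise s hs (SimpleFunc.const Z 1)
            (SimpleFunc.const Z 0)) z : NNReal) : ℝ)) = s.indicator fun _ => 1 := by
          ext z; by_cases hz : z ∈ s <;> simp [hz]
        simp only [h2] at h1
        rw [lintegral_indicator hs, h3, eLpNorm_indicator_const hs one_ne_zero
          ENNReal.one_ne_top] at h1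
        simpa using h1
      refine memLp_top_of_bound hsm ‖φ‖ ?_
      filter_upwards [hle] with z hz
      rw [Real.norm_of_nonneg ENNReal.toReal_nonneg]
      exact ENNReal.toReal_le_of_le_ofReal (norm_nonneg _) hz
    · have hr := ENNReal.HolderConjugate.toReal_of_ne_top hp hq
      refine ⟨hsm, ?_⟩
      rw [eLpNorm_lt_top_iff_lintegral_rpow_enorm_lt_top hq0 hq]
      have h1 : ∫⁻ z, F z ^ q.toReal ∂μ ≤ ENNReal.ofReal ‖φ‖ ^ q.toReal := by
        refine lintegral_rpow_le_of_forall_simpleFunc hFm hr fun s => ?_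
        have h2 := hbd s
        rw [eLpNorm_eq_lintegral_rpow_enorm_toReal hp0 hp] at h2
        simpa using h2
      refine lt_of_le_of_lt (lintegral_mono fun z => ?_) (h1.trans_lt
        (ENNReal.rpow_lt_top_of_nonneg ENNReal.toReal_nonneg ENNReal.ofReal_ne_top))
      exact ENNReal.rpow_le_rpow (hFe z) ENNReal.toReal_nonneg
  let f₀ : Lp ℝ q μ := hmem.toLp
  refine ⟨f₀, ?_⟩
  let ψ : Lp ℝ p μ →L[ℝ] ℝ := (ContinuousLinearMap.mul ℝ ℝ).lpPairing μ q p f₀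
  have hψ : ∀ g, ψ g = ∫ z, f₀ z * g z ∂μ := fun g => by
    simp [ψ, ContinuousLinearMap.lpPairing_eq_integral]
  suffices h : ∀ g, ψ g = φ g from fun g => by rw [← hψ, h]
  refine Lp.induction hp _ (fun c s hs hμs => ?_) (fun f g hf hg _ h1 h2 => ?_)
    (isClosed_eq ψ.continuous φ.continuous)
  · rw [Lp.simpleFunc.coe_indicatorConst]
    have h1 : indicatorConstLp p hs hμs.ne c = c • indicatorConstLp p hs hμs.ne (1 : ℝ) := by
      simp only [indicatorConstLp]
      rw [← MemLp.toLp_const_smul]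
      refine MemLp.toLp_congr _ _ (Eventually.of_forall fun z => ?_)
      by_cases hz : z ∈ s <;> simp [hz]
    rw [h1, map_smul, map_smul, ← hν s hs, hψ]
    congr 1
    have h2 : ∫ z, f₀ z * indicatorConstLp p hs hμs.ne (1 : ℝ) z ∂μ =
        ∫ z, (F z).toReal * s.indicator (fun _ => (1 : ℝ)) z ∂μ := by
      refine integral_congr_ae ?_
      filter_upwards [hmem.coeFn_toLp, indicatorConstLp_coeFn (p := p) (hs := hs)
        (hμs := hμs.ne) (c := (1 : ℝ))] with z h3 h4
      rw [h3, h4]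
    rw [h2, integral_toReal_rnDeriv_mul hac, integral_indicator_const _ hs]
    simp
  · rw [map_add, map_add, h1, h2]

end Duality

/-! ### The weak* topology on `M^q` -/

namespace Mq

variable {Z : Type*} [MeasurableSpace Z] {μ : Measure Z} {p q : ℝ≥0∞}

instance (ν : Mq p q μ) : IsProbabilityMeasure ν.meas := ν.isProb

instance : BorelSpace (Mq p q μ) := ⟨rfl⟩


theorem density_ae_eq (ν : Mq p q μ) :
    ν.density =ᵐ[μ] fun z => (ν.meas.rnDeriv μ z).toReal :=
  MemLp.coeFn_toLp _

/-- The pairing of `ν` with the elements of `L^p`. -/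
def pairing (ν : Mq p q μ) (g : Lp ℝ p μ) : ℝ := ∫ z, ν.density z * g z ∂μ

/-- The weak* topology becomes that of pointwise convergence on `L^p`, so compactness can be
obtained from Tychonoff's theorem. -/
theorem isInducing_pairing : IsInducing (pairing : Mq p q μ → Lp ℝ p μ → ℝ) :=
  ⟨induced_compose⟩

theorem eq_of_meas_eq {ν ν' : Mq p q μ} (h : ν.meas = ν'.meas) : ν = ν' := by
  cases ν; cases ν'; congr

theorem abs_pairing_le [p.HolderConjugate q] [Fact (1 ≤ p)] [Fact (1 ≤ q)] (ν : Mq p q μ) (g : Lp ℝ p μ) :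
    |ν.pairing g| ≤ ‖ν.density‖ * ‖g‖ := by
  rw [pairing]
  have h3 : ‖((ContinuousLinearMap.mul ℝ ℝ).holder (r := 1) ν.density g : Lp ℝ 1 μ)‖ ≤
      ‖ContinuousLinearMap.mul ℝ ℝ‖ * ‖ν.density‖ * ‖g‖ :=
    ContinuousLinearMap.norm_holder_apply_apply_le _ _ _
  have h4 : ∫ z, ν.density z * g z ∂μ =
      ∫ z, (ContinuousLinearMap.mul ℝ ℝ).holder (r := 1) ν.density g z ∂μ := by
    refine integral_congr_ae ?_
    filter_upwards [(ContinuousLinearMap.mul ℝ ℝ).coeFn_holder (r := 1) ν.density g] with z hz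
    simp [hz]
  rw [h4, ← Real.norm_eq_abs]
  refine (norm_integral_le_integral_norm _).trans ?_
  rw [← L1.norm_eq_integral_norm]
  simpa using h3

variable [IsProbabilityMeasure μ]

theorem integral_density_mul (ν : Mq p q μ) (g : Z → ℝ) :
    ∫ z, ν.density z * g z ∂μ = ∫ z, g z ∂ν.meas := by
  rw [← integral_toReal_rnDeriv_mul ν.absCont]
  refine integral_congr_ae ?_
  filter_upwards [ν.density_ae_eq] with z hz
  rw [hz]

theorem pairing_eq (ν : Mq p q μ) (g : Lp ℝ p μ) : ν.pairing g = ∫ z, g z ∂ν.meas :=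
  ν.integral_density_mul _

theorem continuous_integral {g : Z → ℝ} (hg : MemLp g p μ) :
    Continuous fun ν : Mq p q μ => ∫ z, g z ∂ν.meas := by
  have h : (fun ν : Mq p q μ => ∫ z, g z ∂ν.meas) = fun ν => ν.pairing hg.toLp := by
    ext ν
    rw [pairing_eq]
    exact integral_congr_ae (ν.absCont.ae_le hg.coeFn_toLp.symm)
  rw [h]
  exact (continuous_apply _).comp isInducing_pairing.continuous

/-- Masses of measurable sets are weak* continuous, since indicators lie in `L^p`. This turns
measurable rules of nature into kernels. -/
theorem measurable_meas : Measurable (meas : Mq p q μ → Measure Z) := by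
  refine Measure.measurable_of_measurable_coe _ fun s hs => ?_
  have h : (fun ν : Mq p q μ => ν.meas s) =
      fun ν => ENNReal.ofReal (∫ z, s.indicator (fun _ => (1 : ℝ)) z ∂ν.meas) := by
    ext ν
    rw [integral_indicator_const _ hs]
    simp
  rw [h]
  exact (continuous_integral ((memLp_const 1).indicator hs)).measurable.ennreal_ofReal

theorem pairing_smul [Fact (1 ≤ p)] (ν : Mq p q μ) (c : ℝ) (g : Lp ℝ p μ) :
    ν.pairing (c • g) = c * ν.pairing g := by
  simp only [pairing_eq]
  rw [← integral_const_mul]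
  exact integral_congr_ae (ν.absCont.ae_le (Lp.coeFn_smul c g))

theorem pairing_indicator (ν : Mq p q μ) {s : Set Z} (hs : MeasurableSet s) :
    ν.pairing (indicatorConstLp p hs (measure_ne_top μ s) 1) = ν.meas.real s := by
  rw [pairing_eq, integral_congr_ae (ν.absCont.ae_le indicatorConstLp_coeFn),
    integral_indicator_const _ hs]
  simp

variable [p.HolderConjugate q]

theorem integrable_of_memLp (ν : Mq p q μ) {g : Z → ℝ} (hg : MemLp g p μ) :
    Integrable g ν.meas := by
  rw [← integrable_toReal_rnDeriv_mul_iff ν.absCont]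
  exact MemLp.integrable_mul (p := q) (q := p) ν.memLp hg

theorem pairing_add [Fact (1 ≤ p)] (ν : Mq p q μ) (g g' : Lp ℝ p μ) :
    ν.pairing (g + g') = ν.pairing g + ν.pairing g' := by
  simp only [pairing_eq]
  rw [← integral_add (ν.integrable_of_memLp (Lp.memLp g)) (ν.integrable_of_memLp (Lp.memLp g'))]
  exact integral_congr_ae (ν.absCont.ae_le (Lp.coeFn_add g g'))

variable {S : Set (Mq p q μ)} {K : ℝ}

/-- Banach-Alaoglu: the pairings lie in a product of compact intervals. A limit of them is still
linear, bounded and nonnegative on indicators, so it has an `L^q` density, which belongs to the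
weak* closed set of densities. -/
theorem isCompact_of_isClosed [Fact (1 ≤ p)] [Fact (1 ≤ q)] (hp : p ≠ ∞)
    (hK : ∀ ν ∈ S, ‖ν.density‖ ≤ K) (hS : IsClosed[weakStar p q μ] (density '' S)) :
    IsCompact S := by
  rw [isInducing_pairing.isCompact_iff]
  have hbd : ∀ ν ∈ S, ∀ g, |ν.pairing g| ≤ K * ‖g‖ := fun ν hν g =>
    (ν.abs_pairing_le g).trans (mul_le_mul_of_nonneg_right (hK ν hν) (norm_nonneg _))
  have hbox : IsCompact (Set.pi univ fun g : Lp ℝ p μ => Icc (-(K * ‖g‖)) (K * ‖g‖)) :=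
    isCompact_univ_pi fun g => isCompact_Icc
  refine hbox.of_isClosed_subset ?_ ?_
  · rw [← closure_subset_iff_isClosed]
    intro φ hφ
    -- Every closed condition satisfied by all pairings from `S` is inherited by `φ`.
    have hcl : ∀ P : Set (Lp ℝ p μ → ℝ), IsClosed P → (∀ ν ∈ S, ν.pairing ∈ P) → φ ∈ P :=
      fun P hP h => closure_minimal (image_subset_iff.2 h) hP hφ
    have hadd : ∀ g g', φ (g + g') = φ g + φ g' := fun g g' =>
      hcl {φ | φ (g + g') = φ g + φ g'}
        (isClosed_eq (continuous_apply _) (by fun_prop))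
        fun ν _ => ν.pairing_add g g'
    have hsmul : ∀ (c : ℝ) g, φ (c • g) = c * φ g := fun c g =>
      hcl {φ | φ (c • g) = c * φ g}
        (isClosed_eq (continuous_apply _) (by fun_prop))
        fun ν _ => ν.pairing_smul c g
    have hle : ∀ g, |φ g| ≤ K * ‖g‖ := fun g =>
      hcl {φ | |φ g| ≤ K * ‖g‖} (isClosed_le (continuous_apply g).abs continuous_const)
        fun ν hν => hbd ν hν g
    let ψ : Lp ℝ p μ →L[ℝ] ℝ := LinearMap.mkContinuous
      { toFun := φ, map_add' := hadd, map_smul' := hsmul } K hle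
    obtain ⟨f, hf⟩ := exists_Lp_representation (q := q) hp ψ fun s hs =>
      hcl {φ | 0 ≤ φ (indicatorConstLp p hs (measure_ne_top μ s) 1)}
        (isClosed_le continuous_const (continuous_apply _))
        fun ν _ => by rw [mem_ofPred_eq, pairing_indicator]; exact measureReal_nonneg
    have hfφ : (fun g : Lp ℝ p μ => ∫ z, f z * g z ∂μ) = φ := funext hf
    have hmem : f ∈ @closure _ (weakStar p q μ) (density '' S) := by
      refine (closure_induced (f := fun (f : Lp ℝ q μ) (g : Lp ℝ p μ) =>
        ∫ z, f z * g z ∂μ)).2 ?_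
      rw [image_image, hfφ]
      exact hφ
    rw [@IsClosed.closure_eq _ (weakStar p q μ) _ hS] at hmem
    obtain ⟨ν, hν, rfl⟩ := hmem
    exact ⟨ν, hν, hfφ⟩
  · rintro _ ⟨ν, hν, rfl⟩ g -
    exact abs_le.1 (hbd ν hν g)

/-- Pairings with a dense sequence of `L^p` suffice: the norm bound makes `ν.pairing` Lipschitz in
`g` uniformly over `S`. -/
theorem exists_isEmbedding [Fact (1 ≤ p)] [Fact (1 ≤ q)] [SecondCountableTopology (Lp ℝ p μ)]
    (hK : ∀ ν ∈ S, ‖ν.density‖ ≤ K) : ∃ j : S → ℕ → ℝ, IsEmbedding j := by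
  let u := TopologicalSpace.denseSeq (Lp ℝ p μ)
  have hu : DenseRange u := TopologicalSpace.denseRange_denseSeq _
  let j : S → ℕ → ℝ := fun ν n => ν.1.pairing (u n)
  have hpair : IsInducing fun ν : S => ν.1.pairing :=
    isInducing_pairing.comp IsInducing.subtypeVal
  have hdist : ∀ (ν : S) g g', |ν.1.pairing g - ν.1.pairing g'| ≤ (|K| + 1) * ‖g - g'‖ := by
    intro ν g g'
    have h1 : ν.1.pairing g = ν.1.pairing (g - g') + ν.1.pairing g' := by
      rw [← pairing_add, sub_add_cancel]
    rw [h1, add_sub_cancel_right]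
    refine (ν.1.abs_pairing_le _).trans (mul_le_mul_of_nonneg_right ?_ (norm_nonneg _))
    linarith [hK ν.1 ν.2, le_abs_self K]
  have happrox : ∀ (g : Lp ℝ p μ) (ε : ℝ), 0 < ε →
      ∃ n, ∀ ν : S, |ν.1.pairing g - ν.1.pairing (u n)| < ε := by
    intro g ε hε
    have hK1 : 0 < |K| + 1 := by positivity
    obtain ⟨n, hn⟩ := hu.exists_dist_lt g (div_pos hε hK1)
    refine ⟨n, fun ν => (hdist ν _ _).trans_lt ?_⟩
    rw [dist_eq_norm, lt_div_iff₀ hK1] at hn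
    linarith
  refine ⟨j, ⟨⟨le_antisymm ?_ ?_⟩, fun ν ν' h => ?_⟩⟩
  · rw [← continuous_iff_le_induced]
    exact continuous_pi fun n => (continuous_apply (u n)).comp hpair.continuous
  · rw [hpair.eq_induced]
    rw [← continuous_iff_le_induced]
    -- Each pairing is a uniform limit of coordinates of `j`. The topology induced by `j` is named
    -- explicitly because `S` already carries the weak* one.
    refine @continuous_pi _ _ _ (TopologicalSpace.induced j inferInstance) _ _ fun g => ?_
    refine @continuous_of_uniform_approx_of_continuous _ _
      (TopologicalSpace.induced j inferInstance) _ _ fun V hV => ?_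
    obtain ⟨ε, hε, hεV⟩ := Metric.mem_uniformity_dist.1 hV
    obtain ⟨n, hn⟩ := happrox g ε hε
    refine ⟨fun ν => j ν n, ?_, fun ν => hεV (hn ν)⟩
    exact @Continuous.comp _ _ _ (TopologicalSpace.induced j inferInstance) _ _ j
      (fun w => w n) (continuous_apply n) continuous_induced_dom
  · have heq : ∀ g, ν.1.pairing g = ν'.1.pairing g := by
      intro g
      refine eq_of_forall_dist_le fun ε hε => ?_
      rw [Real.dist_eq]
      obtain ⟨n, hn⟩ := happrox g (ε / 2) (by positivity)
      have h1 := hn ν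
      have h2 := hn ν'
      have h3 : ν.1.pairing (u n) = ν'.1.pairing (u n) := congrFun h n
      rw [h3] at h1
      rw [abs_sub_comm] at h2
      have := abs_sub_le (ν.1.pairing g) (ν'.1.pairing (u n)) (ν'.1.pairing g)
      linarith
    refine Subtype.ext (eq_of_meas_eq (Measure.ext fun s hs => ?_))
    have h1 := heq (indicatorConstLp p hs (measure_ne_top μ s) 1)
    rw [pairing_indicator, pairing_indicator] at h1
    exact (measureReal_eq_measureReal_iff).1 h1

/-- Convex combinations within a set of measures with a convex set of densities. -/
theorem exists_integral_eq_of_convex [Fact (1 ≤ q)] (hS : Convex ℝ (density '' S)) {ν ν' : Mq p q μ}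
    (hν : ν ∈ S) (hν' : ν' ∈ S) {s t : ℝ} (hs : 0 ≤ s) (ht : 0 ≤ t) (hst : s + t = 1) :
    ∃ κ ∈ S, ∀ g : Z → ℝ, MemLp g p μ →
      ∫ z, g z ∂κ.meas = s * ∫ z, g z ∂ν.meas + t * ∫ z, g z ∂ν'.meas := by
  obtain ⟨κ, hκ, hκd⟩ := hS ⟨ν, hν, rfl⟩ ⟨ν', hν', rfl⟩ hs ht hst
  refine ⟨κ, hκ, fun g hg => ?_⟩
  have hi : ∀ ν : Mq p q μ, Integrable (fun z => ν.density z * g z) μ := fun ν =>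
    MemLp.integrable_mul (p := q) (q := p) (Lp.memLp ν.density) hg
  rw [← integral_density_mul, ← integral_density_mul, ← integral_density_mul,
    ← integral_const_mul, ← integral_const_mul,
    ← integral_add ((hi ν).const_mul s) ((hi ν').const_mul t), hκd]
  refine integral_congr_ae ?_
  filter_upwards [Lp.coeFn_add (s • ν.density) (t • ν'.density), Lp.coeFn_smul s ν.density,
    Lp.coeFn_smul t ν'.density] with z h1 h2 h3
  rw [h1, Pi.add_apply, h2, h3]
  simp only [Pi.smul_apply, smul_eq_mul]
  ring

end Mq

namespace Model

open ProbabilityTheory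

variable {N : ℕ} {A Z : Type*} [MeasurableSpace Z] {p q : ℝ≥0∞}

/-- Cost of stage `k` plus a continuation value `V` of the next state. -/
def stage (M : Model N A Z p q) (k : Fin N) (V : ℝ → ℝ) (y : ℝ × A) (z : Z) : ℝ :=
  M.c k y (M.T k y z) + V (M.T k y z)

/-- Expected cost of stage `k` plus continuation value. -/
def stageCost (M : Model N A Z p q) (k : Fin N) (V : ℝ → ℝ) (y : ℝ × A) (ν : M.Q k) : ℝ :=
  ∫ z, M.stage k V y z ∂ν.1.meas

/-! ### The law of motion and the total cost along a path -/

theorem law_last (M : Model N A Z p q) (act : Fin N → ℝ → A) (amb : ∀ k, ℝ → M.Q k) (x : ℝ) :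
    M.law act amb (Fin.last N) x = Measure.dirac (fun _ => x) := by
  simp [law]

theorem law_castSucc (M : Model N A Z p q) (act : Fin N → ℝ → A) (amb : ∀ k, ℝ → M.Q k)
    (k : Fin N) (x : ℝ) :
    M.law act amb k.castSucc x = (M.step act amb k x).bind fun x' =>
      (M.law act amb k.succ x').map (fun ω => Function.update ω k.castSucc x) := by
  simp [law]

theorem totalCost_last (M : Model N A Z p q) (act : Fin N → ℝ → A) (ω : Fin (N + 1) → ℝ) :
    M.totalCost act (Fin.last N) ω = M.cN (ω (Fin.last N)) := by
  simp [totalCost]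

theorem totalCost_update (M : Model N A Z p q) (act : Fin N → ℝ → A) (k : Fin N)
    (ω : Fin (N + 1) → ℝ) (x : ℝ) :
    M.totalCost act k.castSucc (Function.update ω k.castSucc x) =
      M.c k (x, act k x) (ω k.succ) + M.totalCost act k.succ ω := by
  have hfil : (Finset.univ.filter fun j : Fin N => k.castSucc ≤ j.castSucc) =
      insert k (Finset.univ.filter fun j : Fin N => k.succ ≤ j.castSucc) := by
    ext j
    simp only [Finset.mem_filter, Finset.mem_univ, true_and, Finset.mem_insert, Fin.le_def,
      Fin.ext_iff, Fin.val_castSucc, Fin.val_succ]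
    omega
  have hk : k ∉ Finset.univ.filter fun j : Fin N => k.succ ≤ j.castSucc := by
    simp [Fin.le_def]
  have hne : ∀ i : Fin (N + 1), k.castSucc < i → Function.update ω k.castSucc x i = ω i :=
    fun i hi => Function.update_of_ne hi.ne' _ _
  rw [totalCost, hfil, Finset.sum_insert hk, totalCost, add_assoc, Function.update_self,
    hne _ (Fin.castSucc_lt_succ), hne _ (Fin.castSucc_lt_last k)]
  congr 2
  refine Finset.sum_congr rfl fun j hj => ?_
  have hj' : k.castSucc < j.castSucc := by
    have := (Finset.mem_filter.1 hj).2
    simp only [Fin.le_def, Fin.lt_def, Fin.val_castSucc, Fin.val_succ] at *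
    omega
  rw [hne _ hj', hne _ (hj'.trans Fin.castSucc_lt_succ)]

theorem measurable_update_pair (i : Fin (N + 1)) :
    Measurable fun u : ℝ × (Fin (N + 1) → ℝ) => Function.update u.2 i u.1 := by
  refine measurable_pi_iff.2 fun j => ?_
  by_cases hj : j = i
  · subst hj; simpa using measurable_fst
  · simp only [Function.update_of_ne hj]; fun_prop

/-! ### Measurability and integrability under a single bounding function -/

variable [TopologicalSpace A] [MeasurableSpace A]

/-- Measurability and integrability of the data with respect to a bounding function `b`. -/
structure BoundedBy (M : Model N A Z p q) (b : ℝ → ℝ) (α : ℝ) : Prop where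
  isProb_P : ∀ k, IsProbabilityMeasure (M.P k)
  measurable_b : Measurable b
  one_le_b : ∀ x, 1 ≤ b x
  alpha_nonneg : 0 ≤ α
  measurable_T : ∀ k, Measurable (fun y : M.D k × Z => M.T k y.1 y.2)
  measurable_c : ∀ k, Measurable (fun w : M.D k × ℝ => M.c k w.1 w.2)
  measurable_cN : Measurable M.cN
  abs_cN_le : ∀ x, |M.cN x| ≤ b x
  integral_abs_c_le : ∀ k, ∀ ν ∈ M.Q k, ∀ y ∈ M.D k,
    ∫ z, |M.c k y (M.T k y z)| ∂ν.meas ≤ b y.1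
  integral_b_le : ∀ k, ∀ ν ∈ M.Q k, ∀ y ∈ M.D k, ∫ z, b (M.T k y z) ∂ν.meas ≤ α * b y.1
  local_bound : ∀ k, ∀ y₀ ∈ M.D k, ∃ Θ : Z → ℝ, MemLp Θ p (M.P k) ∧
    ∀ᶠ y in 𝓝[M.D k] y₀, ∀ z, |M.c k y (M.T k y z)| ≤ Θ z ∧ b (M.T k y z) ≤ Θ z

namespace BoundedBy

variable {M : Model N A Z p q} {b : ℝ → ℝ} {α : ℝ}

theorem measurable_T_section (h : M.BoundedBy b α) {k : Fin N} {y : ℝ × A} (hy : y ∈ M.D k) :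
    Measurable (M.T k y) :=
  (h.measurable_T k).comp (measurable_const.prodMk measurable_id : Measurable fun z =>
    ((⟨y, hy⟩ : M.D k), z))

theorem measurable_c_section (h : M.BoundedBy b α) {k : Fin N} {y : ℝ × A} (hy : y ∈ M.D k) :
    Measurable (M.c k y) :=
  (h.measurable_c k).comp (measurable_const.prodMk measurable_id : Measurable fun x =>
    ((⟨y, hy⟩ : M.D k), x))

theorem memLp_c (h : M.BoundedBy b α) {k : Fin N} {y : ℝ × A} (hy : y ∈ M.D k) :
    MemLp (fun z => M.c k y (M.T k y z)) p (M.P k) := by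
  obtain ⟨Θ, hΘ, hle⟩ := h.local_bound k y hy
  refine hΘ.mono ((h.measurable_c_section hy).comp
    (h.measurable_T_section hy)).aestronglyMeasurable (Eventually.of_forall fun z => ?_)
  exact ((hle.self_of_nhdsWithin hy z).1).trans (le_abs_self _)

theorem memLp_comp (h : M.BoundedBy b α) {k : Fin N} {y : ℝ × A} (hy : y ∈ M.D k)
    {V : ℝ → ℝ} (hV : Measurable V) {C : ℝ} (hVb : ∀ x, |V x| ≤ C * b x) :
    MemLp (fun z => V (M.T k y z)) p (M.P k) := by
  obtain ⟨Θ, hΘ, hle⟩ := h.local_bound k y hy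
  refine (hΘ.const_mul |C|).mono (hV.comp (h.measurable_T_section hy)).aestronglyMeasurable
    (Eventually.of_forall fun z => ?_)
  have h1 := hVb (M.T k y z)
  have h2 := (hle.self_of_nhdsWithin hy z).2
  have h3 := h.one_le_b (M.T k y z)
  calc ‖V (M.T k y z)‖ ≤ C * b (M.T k y z) := h1
    _ ≤ |C| * b (M.T k y z) := mul_le_mul_of_nonneg_right (le_abs_self C) (by linarith)
    _ ≤ |C| * Θ z := mul_le_mul_of_nonneg_left h2 (abs_nonneg C)
    _ ≤ ‖|C| * Θ z‖ := le_abs_self _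

theorem memLp_stage (h : M.BoundedBy b α) {k : Fin N} {y : ℝ × A} (hy : y ∈ M.D k)
    {V : ℝ → ℝ} (hV : Measurable V) {C : ℝ} (hVb : ∀ x, |V x| ≤ C * b x) :
    MemLp (M.stage k V y) p (M.P k) :=
  (h.memLp_c hy).add (h.memLp_comp hy hV hVb)

theorem continuous_stageCost (h : M.BoundedBy b α) {k : Fin N} {y : ℝ × A} (hy : y ∈ M.D k)
    {V : ℝ → ℝ} (hV : Measurable V) {C : ℝ} (hVb : ∀ x, |V x| ≤ C * b x) :
    Continuous (M.stageCost k V y) :=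
  have := h.isProb_P k
  (Mq.continuous_integral (h.memLp_stage hy hV hVb)).comp continuous_subtype_val

theorem measurable_T_rule (h : M.BoundedBy b α) {k : Fin N} {d : ℝ → A} (hd : Measurable d)
    (hdD : ∀ x, (x, d x) ∈ M.D k) : Measurable fun u : ℝ × Z => M.T k (u.1, d u.1) u.2 :=
  (h.measurable_T k).comp (((measurable_fst.prodMk
    (hd.comp measurable_fst)).subtype_mk (h := fun u : ℝ × Z => hdD u.1)).prodMk measurable_snd)

theorem measurable_c_rule (h : M.BoundedBy b α) {k : Fin N} {d : ℝ → A} (hd : Measurable d)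
    (hdD : ∀ x, (x, d x) ∈ M.D k) : Measurable fun u : ℝ × ℝ => M.c k (u.1, d u.1) u.2 :=
  (h.measurable_c k).comp (((measurable_fst.prodMk
    (hd.comp measurable_fst)).subtype_mk (h := fun u : ℝ × ℝ => hdD u.1)).prodMk measurable_snd)

theorem isProbabilityMeasure_step (h : M.BoundedBy b α) {act : Fin N → ℝ → A}
    (hact : act ∈ M.ctrlX) {amb : ∀ k, ℝ → M.Q k} (k : Fin N) (x : ℝ) :
    IsProbabilityMeasure (M.step act amb k x) :=
  Measure.isProbabilityMeasure_map (h.measurable_T_section ((hact k).2 x)).aemeasurable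

theorem measurable_totalCost (h : M.BoundedBy b α) {act : Fin N → ℝ → A}
    (hact : act ∈ M.ctrlX) (n : Fin (N + 1)) : Measurable (M.totalCost act n) := by
  refine (Finset.measurable_sum _ fun k _ => ?_).add (h.measurable_cN.comp (measurable_pi_apply _))
  exact (h.measurable_c_rule (hact k).1 (hact k).2).comp (g := fun u : ℝ × ℝ =>
    M.c k (u.1, act k u.1) u.2) (f := fun ω : Fin (N + 1) → ℝ => (ω k.castSucc, ω k.succ))
    ((measurable_pi_apply k.castSucc).prodMk (measurable_pi_apply k.succ))

theorem value_last (h : M.BoundedBy b α) {act : Fin N → ℝ → A} (hact : act ∈ M.ctrlX)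
    {amb : ∀ k, ℝ → M.Q k} (x : ℝ) :
    M.value act amb (Fin.last N) x = M.cN x := by
  rw [value, law_last, integral_dirac' _ _ (h.measurable_totalCost hact _).stronglyMeasurable,
    totalCost_last]

/-! ### Measurability of the law of motion -/

/-- The disturbance kernel of a measurable rule of nature. -/
def disturbance (h : M.BoundedBy b α) {k : Fin N} {γ : ℝ → M.Q k} (hγ : Measurable γ) :
    Kernel ℝ Z :=
  have := h.isProb_P k
  ⟨fun x => (γ x).1.meas, Mq.measurable_meas.comp (measurable_subtype_coe.comp hγ)⟩

instance (h : M.BoundedBy b α) {k : Fin N} {γ : ℝ → M.Q k} (hγ : Measurable γ) :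
    IsMarkovKernel (h.disturbance hγ) :=
  ⟨fun x => (γ x).1.isProb⟩

theorem measurable_stageCost (h : M.BoundedBy b α) {k : Fin N} {d : ℝ → A} (hd : Measurable d)
    (hdD : ∀ x, (x, d x) ∈ M.D k) {γ : ℝ → M.Q k} (hγ : Measurable γ) {V : ℝ → ℝ}
    (hV : Measurable V) : Measurable fun x => M.stageCost k V (x, d x) (γ x) := by
  have hT := h.measurable_T_rule hd hdD
  have hm : Measurable fun u : ℝ × Z => M.stage k V (u.1, d u.1) u.2 :=
    ((h.measurable_c_rule hd hdD).comp (measurable_fst.prodMk hT)).add (hV.comp hT)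
  exact (StronglyMeasurable.integral_kernel_prod_right' (κ := h.disturbance hγ)
    hm.stronglyMeasurable).measurable

theorem measurable_step (h : M.BoundedBy b α) {act : Fin N → ℝ → A} (hact : act ∈ M.ctrlX)
    {amb : ∀ k, ℝ → M.Q k} (hamb : amb ∈ M.natX) (k : Fin N) :
    Measurable (M.step act amb k) := by
  refine Measure.measurable_of_measurable_coe _ fun s hs => ?_
  have hT := h.measurable_T_rule (hact k).1 (hact k).2
  have h1 : (fun x => M.step act amb k x s) = fun x => h.disturbance (hamb k) x
      (Prod.mk x ⁻¹' ((fun u : ℝ × Z => M.T k (u.1, act k u.1) u.2) ⁻¹' s)) := by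
    ext x
    exact Measure.map_apply (h.measurable_T_section ((hact k).2 x)) hs
  rw [h1]
  exact Kernel.measurable_kernel_prodMk_left (hT hs)

variable {act : Fin N → ℝ → A} {amb : ∀ k, ℝ → M.Q k}

theorem law_spec (h : M.BoundedBy b α) (hact : act ∈ M.ctrlX) (hamb : amb ∈ M.natX)
    (n : Fin (N + 1)) :
    Measurable (M.law act amb n) ∧ ∀ x, IsProbabilityMeasure (M.law act amb n x) := by
  induction n using Fin.reverseInduction with
  | last =>
    have : M.law act amb (Fin.last N) = fun x => Measure.dirac fun _ => x :=
      funext fun x => M.law_last act amb x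
    rw [this]
    exact ⟨Measure.measurable_dirac.comp (measurable_pi_iff.2 fun _ => measurable_id),
      fun x => inferInstance⟩
  | cast k ih =>
    obtain ⟨hm, hp⟩ := ih
    have hup : ∀ x : ℝ, Measurable fun ω : Fin (N + 1) → ℝ => Function.update ω k.castSucc x :=
      fun x => (measurable_update_pair k.castSucc).comp (measurable_const.prodMk measurable_id)
    have hmap : ∀ x : ℝ, Measurable fun x' =>
        (M.law act amb k.succ x').map (fun ω => Function.update ω k.castSucc x) := fun x =>
      (Measure.measurable_map _ (hup x)).comp hm
    constructor
    -- The state `x` enters through the step law and through the update, so the mass of `s` is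
    -- written as the integral against `κ x` of a function jointly measurable in `(x, x')`.
    · let κ : Kernel ℝ ℝ := ⟨M.step act amb k, h.measurable_step hact hamb k⟩
      have : IsMarkovKernel κ := ⟨h.isProbabilityMeasure_step hact k⟩
      let η : Kernel (ℝ × ℝ) (Fin (N + 1) → ℝ) :=
        ⟨fun u => M.law act amb k.succ u.2, hm.comp measurable_snd⟩
      have : IsMarkovKernel η := ⟨fun u => hp u.2⟩
      refine Measure.measurable_of_measurable_coe _ fun s hs => ?_
      have h1 : (fun x => M.law act amb k.castSucc x s) = fun x => ∫⁻ x', η (x, x')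
          (Prod.mk (x, x') ⁻¹' ((fun u : (ℝ × ℝ) × (Fin (N + 1) → ℝ) =>
            Function.update u.2 k.castSucc u.1.1) ⁻¹' s)) ∂κ x := by
        ext x
        rw [law_castSucc, Measure.bind_apply hs (hmap x).aemeasurable]
        refine lintegral_congr fun x' => ?_
        rw [Measure.map_apply (hup x) hs]
        rfl
      rw [h1]
      have h2 : Measurable fun u : (ℝ × ℝ) × (Fin (N + 1) → ℝ) =>
          Function.update u.2 k.castSucc u.1.1 :=
        (measurable_update_pair k.castSucc).comp
          ((measurable_fst.comp measurable_fst).prodMk measurable_snd)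
      exact Measurable.lintegral_kernel_prod_right' (κ := κ)
        (Kernel.measurable_kernel_prodMk_left (κ := η) (h2 hs))
    · intro x
      have := h.isProbabilityMeasure_step (amb := amb) hact k x
      rw [law_castSucc]
      exact isProbabilityMeasure_bind (hmap x).aemeasurable (Eventually.of_forall fun x' =>
        have := hp x'
        Measure.isProbabilityMeasure_map (hup x).aemeasurable)

/-- This lets the value iteration replace the random coordinate at time `n` by the known state. -/
theorem ae_law_eq (h : M.BoundedBy b α) (hact : act ∈ M.ctrlX) (hamb : amb ∈ M.natX)
    (n : Fin (N + 1)) (x : ℝ) : ∀ᵐ ω ∂M.law act amb n x, ω n = x := by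
  have hms : ∀ i, MeasurableSet {ω : Fin (N + 1) → ℝ | ω i = x} := fun i =>
    measurableSet_eq_fun (measurable_pi_apply i) measurable_const
  cases n using Fin.lastCases with
  | last =>
    rw [law_last, ae_dirac_iff (hms _)]
  | cast k =>
    have hup : Measurable fun ω : Fin (N + 1) → ℝ => Function.update ω k.castSucc x :=
      (measurable_update_pair k.castSucc).comp (measurable_const.prodMk measurable_id)
    rw [law_castSucc, ae_iff]
    have hmc : MeasurableSet {ω : Fin (N + 1) → ℝ | ¬ω k.castSucc = x} := (hms _).compl
    have hmap : Measurable fun x' =>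
        (M.law act amb k.succ x').map (fun ω => Function.update ω k.castSucc x) :=
      (Measure.measurable_map _ hup).comp (h.law_spec hact hamb k.succ).1
    change ((M.step act amb k x).bind _) {ω : Fin (N + 1) → ℝ | ¬ω k.castSucc = x} = 0
    rw [Measure.bind_apply hmc hmap.aemeasurable]
    refine (lintegral_congr fun x' => ?_).trans lintegral_zero
    rw [Measure.map_apply hup hmc]
    simp

/-- One step of the law of motion, for nonnegative integrands. -/
theorem lintegral_law_castSucc (h : M.BoundedBy b α) (hact : act ∈ M.ctrlX) (hamb : amb ∈ M.natX)
    (k : Fin N) (x : ℝ) {f : (Fin (N + 1) → ℝ) → ℝ≥0∞} (hf : Measurable f) :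
    ∫⁻ ω, f ω ∂M.law act amb k.castSucc x =
      ∫⁻ z, ∫⁻ ω, f (Function.update ω k.castSucc x)
        ∂M.law act amb k.succ (M.T k (x, act k x) z) ∂(amb k x).1.meas := by
  have hup : Measurable fun ω : Fin (N + 1) → ℝ => Function.update ω k.castSucc x :=
    (measurable_update_pair k.castSucc).comp (measurable_const.prodMk measurable_id)
  have hmap : Measurable fun x' =>
      (M.law act amb k.succ x').map (fun ω => Function.update ω k.castSucc x) :=
    (Measure.measurable_map _ hup).comp (h.law_spec hact hamb k.succ).1
  rw [law_castSucc, Measure.lintegral_bind hmap.aemeasurable hf.aemeasurable, step,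
    lintegral_map (f := fun x' => ∫⁻ ω, f ω ∂((M.law act amb k.succ x').map
      (fun ω => Function.update ω k.castSucc x))) ((Measure.measurable_lintegral hf).comp hmap)
      (h.measurable_T_section ((hact k).2 x))]
  exact lintegral_congr fun z => lintegral_map hf hup

/-- One step of the law of motion, for integrable functions. -/
theorem integral_law_castSucc (h : M.BoundedBy b α) (hact : act ∈ M.ctrlX) (hamb : amb ∈ M.natX)
    (k : Fin N) (x : ℝ) {f : (Fin (N + 1) → ℝ) → ℝ} (hf : Measurable f)
    (hi : Integrable f (M.law act amb k.castSucc x)) :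
    ∫ ω, f ω ∂M.law act amb k.castSucc x =
      ∫ z, ∫ ω, f (Function.update ω k.castSucc x)
        ∂M.law act amb k.succ (M.T k (x, act k x) z) ∂(amb k x).1.meas := by
  have hup : Measurable fun ω : Fin (N + 1) → ℝ => Function.update ω k.castSucc x :=
    (measurable_update_pair k.castSucc).comp (measurable_const.prodMk measurable_id)
  have hmap : Measurable fun x' =>
      (M.law act amb k.succ x').map (fun ω => Function.update ω k.castSucc x) :=
    (Measure.measurable_map _ hup).comp (h.law_spec hact hamb k.succ).1
  let η : Kernel ℝ (Fin (N + 1) → ℝ) := ⟨_, hmap⟩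
  have hη : IsMarkovKernel η := ⟨fun x' =>
    have := (h.law_spec hact hamb k.succ).2 x'
    Measure.isProbabilityMeasure_map hup.aemeasurable⟩
  have hcomp : M.law act amb k.castSucc x =
      (η ∘ₖ Kernel.const Unit (M.step act amb k x)) () := by
    rw [law_castSucc, Kernel.comp_apply, Kernel.const_apply]
    rfl
  rw [hcomp] at hi ⊢
  have := h.isProbabilityMeasure_step (amb := amb) hact k x
  rw [Kernel.integral_comp hi, Kernel.const_apply, step,
    integral_map (h.measurable_T_section ((hact k).2 x)).aemeasurable
      (hf.stronglyMeasurable.integral_kernel (κ := η)).aestronglyMeasurable]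
  exact integral_congr_ae (Eventually.of_forall fun z =>
    integral_map hup.aemeasurable hf.aestronglyMeasurable)

theorem measurable_value (h : M.BoundedBy b α) (hact : act ∈ M.ctrlX)
    (hamb : amb ∈ M.natX) (n : Fin (N + 1)) : Measurable (M.value act amb n) := by
  let κ : Kernel ℝ (Fin (N + 1) → ℝ) := ⟨M.law act amb n, (h.law_spec hact hamb n).1⟩
  have : IsMarkovKernel κ := ⟨(h.law_spec hact hamb n).2⟩
  exact ((h.measurable_totalCost hact n).stronglyMeasurable.integral_kernel (κ := κ)).measurable

/-! ### Growth bounds and the value iteration -/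

variable [p.HolderConjugate q]

theorem integrable_c (h : M.BoundedBy b α) {k : Fin N} {y : ℝ × A} (hy : y ∈ M.D k)
    (ν : Mq p q (M.P k)) : Integrable (fun z => M.c k y (M.T k y z)) ν.meas :=
  have := h.isProb_P k
  ν.integrable_of_memLp (h.memLp_c hy)

theorem integrable_comp (h : M.BoundedBy b α) {k : Fin N} {y : ℝ × A} (hy : y ∈ M.D k)
    {V : ℝ → ℝ} (hV : Measurable V) {C : ℝ} (hVb : ∀ x, |V x| ≤ C * b x)
    (ν : Mq p q (M.P k)) : Integrable (fun z => V (M.T k y z)) ν.meas :=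
  have := h.isProb_P k
  ν.integrable_of_memLp (h.memLp_comp hy hV hVb)

theorem integrable_stage (h : M.BoundedBy b α) {k : Fin N} {y : ℝ × A} (hy : y ∈ M.D k)
    {V : ℝ → ℝ} (hV : Measurable V) {C : ℝ} (hVb : ∀ x, |V x| ≤ C * b x)
    (ν : Mq p q (M.P k)) : Integrable (M.stage k V y) ν.meas :=
  have := h.isProb_P k
  ν.integrable_of_memLp (h.memLp_stage hy hV hVb)

theorem integrable_b (h : M.BoundedBy b α) {k : Fin N} {y : ℝ × A} (hy : y ∈ M.D k)
    (ν : Mq p q (M.P k)) : Integrable (fun z => b (M.T k y z)) ν.meas :=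
  h.integrable_comp hy h.measurable_b (C := 1) (fun x => by
    rw [abs_of_nonneg (by linarith [h.one_le_b x]), one_mul]) ν

theorem integral_abs_le (h : M.BoundedBy b α) {k : Fin N} {y : ℝ × A} (hy : y ∈ M.D k)
    {C : ℝ} (hC : 0 ≤ C) (ν : M.Q k) :
    ∫ z, (|M.c k y (M.T k y z)| + C * b (M.T k y z)) ∂ν.1.meas ≤ (1 + C * α) * b y.1 := by
  rw [integral_add (h.integrable_c hy ν.1).abs ((h.integrable_b hy ν.1).const_mul C),
    integral_const_mul]
  have h1 := h.integral_abs_c_le k ν.1 ν.2 y hy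
  have h2 := mul_le_mul_of_nonneg_left (h.integral_b_le k ν.1 ν.2 y hy) hC
  linarith

theorem abs_stageCost_le (h : M.BoundedBy b α) {k : Fin N} {y : ℝ × A} (hy : y ∈ M.D k)
    {V : ℝ → ℝ} {C : ℝ} (hC : 0 ≤ C) (hVb : ∀ x, |V x| ≤ C * b x) (ν : M.Q k) :
    |M.stageCost k V y ν| ≤ (1 + C * α) * b y.1 := by
  refine le_trans ?_ (h.integral_abs_le hy hC ν)
  rw [stageCost, ← Real.norm_eq_abs]
  refine norm_integral_le_of_norm_le
    ((h.integrable_c hy ν.1).abs.add ((h.integrable_b hy ν.1).const_mul C))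
    (Eventually.of_forall fun z => ?_)
  exact (abs_add_le _ _).trans (add_le_add le_rfl (hVb _))

theorem stageCost_mono (h : M.BoundedBy b α) {k : Fin N} {y : ℝ × A} (hy : y ∈ M.D k)
    {V W : ℝ → ℝ} (hV : Measurable V) (hW : Measurable W) {C C' : ℝ} (hVb : ∀ x, |V x| ≤ C * b x)
    (hWb : ∀ x, |W x| ≤ C' * b x) (hVW : ∀ x, V x ≤ W x) (ν : M.Q k) :
    M.stageCost k V y ν ≤ M.stageCost k W y ν :=
  integral_mono (h.integrable_stage hy hV hVb ν.1) (h.integrable_stage hy hW hWb ν.1)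
    fun _ => add_le_add le_rfl (hVW _)

/-- Backward induction: a stage costs at most `b` on average and the expectation of `b` grows by at
most the factor `α`, so `C` becomes `1 + C * α`. Working with `∫⁻` makes integrability a conclusion.
-/
theorem exists_lintegral_totalCost_le (h : M.BoundedBy b α) (hact : act ∈ M.ctrlX)
    (hamb : amb ∈ M.natX) (n : Fin (N + 1)) : ∃ C : ℝ, 0 ≤ C ∧
      ∀ x, ∫⁻ ω, ‖M.totalCost act n ω‖ₑ ∂M.law act amb n x ≤ ENNReal.ofReal (C * b x) := by
  have hm := fun n => (h.measurable_totalCost hact n).enorm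
  induction n using Fin.reverseInduction with
  | last =>
    refine ⟨1, zero_le_one, fun x => ?_⟩
    rw [law_last, lintegral_dirac' _ (hm _), totalCost_last, one_mul, Real.enorm_eq_ofReal_abs]
    exact ENNReal.ofReal_le_ofReal (h.abs_cN_le x)
  | cast k ih =>
    obtain ⟨C, hC, ih⟩ := ih
    refine ⟨1 + C * α, by have := h.alpha_nonneg; positivity, fun x => ?_⟩
    have hy := (hact k).2 x
    rw [h.lintegral_law_castSucc hact hamb k x (hm _)]
    simp only [totalCost_update]
    have hb0 : ∀ x, 0 ≤ C * b x := fun x => mul_nonneg hC (by linarith [h.one_le_b x])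
    calc _ ≤ ∫⁻ z, ENNReal.ofReal (|M.c k (x, act k x) (M.T k (x, act k x) z)| +
          C * b (M.T k (x, act k x) z)) ∂(amb k x).1.meas := by
          refine lintegral_mono fun z => ?_
          have := (h.law_spec hact hamb k.succ).2 (M.T k (x, act k x) z)
          rw [ENNReal.ofReal_add (abs_nonneg _) (hb0 _)]
          calc _ ≤ ∫⁻ ω, (‖M.c k (x, act k x) (M.T k (x, act k x) z)‖ₑ +
                ‖M.totalCost act k.succ ω‖ₑ) ∂M.law act amb k.succ (M.T k (x, act k x) z) := by
                refine lintegral_mono_ae ?_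
                filter_upwards [h.ae_law_eq hact hamb k.succ (M.T k (x, act k x) z)] with ω hω
                rw [hω]
                exact enorm_add_le _ _
            _ ≤ _ := by
                rw [lintegral_add_left measurable_const, lintegral_const, measure_univ, mul_one,
                  Real.enorm_eq_ofReal_abs]
                exact add_le_add le_rfl (ih _)
      _ ≤ ENNReal.ofReal ((1 + C * α) * b x) := by
          rw [← ofReal_integral_eq_lintegral_ofReal]
          · exact ENNReal.ofReal_le_ofReal (h.integral_abs_le hy hC (amb k x))
          · exact (h.integrable_c hy (amb k x).1).abs.add
              ((h.integrable_b hy (amb k x).1).const_mul C)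
          · exact Eventually.of_forall fun z => add_nonneg (abs_nonneg _) (hb0 _)

theorem integrable_totalCost (h : M.BoundedBy b α) (hact : act ∈ M.ctrlX)
    (hamb : amb ∈ M.natX) (n : Fin (N + 1)) (x : ℝ) :
    Integrable (M.totalCost act n) (M.law act amb n x) := by
  obtain ⟨C, -, hC⟩ := h.exists_lintegral_totalCost_le hact hamb n
  exact ⟨(h.measurable_totalCost hact n).aestronglyMeasurable,
    (hC x).trans_lt ENNReal.ofReal_lt_top⟩

theorem exists_abs_value_le (h : M.BoundedBy b α) (hact : act ∈ M.ctrlX)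
    (hamb : amb ∈ M.natX) (n : Fin (N + 1)) :
    ∃ C : ℝ, 0 ≤ C ∧ ∀ x, |M.value act amb n x| ≤ C * b x := by
  obtain ⟨C, hC0, hC⟩ := h.exists_lintegral_totalCost_le hact hamb n
  refine ⟨C, hC0, fun x => ?_⟩
  rw [← Real.norm_eq_abs, value]
  refine (norm_integral_le_lintegral_norm _).trans ?_
  refine ENNReal.toReal_le_of_le_ofReal (mul_nonneg hC0 (by linarith [h.one_le_b x])) ?_
  simpa only [ofReal_norm] using hC x

/-- The value iteration. -/
theorem value_castSucc (h : M.BoundedBy b α) (hact : act ∈ M.ctrlX)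
    (hamb : amb ∈ M.natX) (k : Fin N) (x : ℝ) :
    M.value act amb k.castSucc x =
      M.stageCost k (M.value act amb k.succ) (x, act k x) (amb k x) := by
  rw [value, h.integral_law_castSucc hact hamb k x (h.measurable_totalCost hact _)
    (h.integrable_totalCost hact hamb _ x), stageCost]
  refine integral_congr_ae (Eventually.of_forall fun z => ?_)
  have := (h.law_spec hact hamb k.succ).2 (M.T k (x, act k x) z)
  simp only [totalCost_update, stage, value]
  have h1 : ∫ ω, (M.c k (x, act k x) (ω k.succ) + M.totalCost act k.succ ω)
      ∂M.law act amb k.succ (M.T k (x, act k x) z) =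
      ∫ ω, (M.c k (x, act k x) (M.T k (x, act k x) z) + M.totalCost act k.succ ω)
      ∂M.law act amb k.succ (M.T k (x, act k x) z) := by
    refine integral_congr_ae ?_
    filter_upwards [h.ae_law_eq hact hamb k.succ (M.T k (x, act k x) z)] with ω hω
    rw [hω]
  rw [h1, integral_add (integrable_const _) (h.integrable_totalCost hact hamb _ _)]
  simp

end BoundedBy

end Model

namespace Model

variable {N : ℕ} {A Z : Type*} [TopologicalSpace A] [MeasurableSpace Z] {p q : ℝ≥0∞}

/-! ### From two bounding functions to one -/

section Bounding

variable [SecondCountableTopology A] [MeasurableSpace A] [BorelSpace A]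

theorem RealLine.measurable_c {M : Model N A Z p q} (hR : M.RealLine) (k : Fin N) :
    Measurable (fun w : M.D k × ℝ => M.c k w.1 w.2) := by
  have h : LowerSemicontinuous (fun w : M.D k × ℝ => M.c k w.1 w.2) := by
    intro w t ht
    have h1 := hR.lsc_c k (w.1.1, w.2) ⟨w.1.2, mem_univ _⟩ t ht
    have h2 : Tendsto (fun w : M.D k × ℝ => (w.1.1, w.2)) (𝓝 w)
        (𝓝[M.D k ×ˢ univ] (w.1.1, w.2)) :=
      tendsto_nhdsWithin_iff.2 ⟨(by fun_prop : Continuous fun w : M.D k × ℝ =>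
        (w.1.1, w.2)).tendsto w, Eventually.of_forall fun w => ⟨w.1.2, mem_univ _⟩⟩
    exact h2.eventually h1
  exact h.measurable

/-- Take `b = bup - blo`. It is at least `εlo + εup = 1`, and `|c| = c⁺ + c⁻` adds the two one-sided
bounds. -/
theorem exists_boundedBy [p.HolderConjugate q] {M : Model N A Z p q} (hM : M.Standing)
    (hB : M.Bounding) (hR : M.RealLine) : ∃ b α, M.BoundedBy b α := by
  obtain ⟨α, εlo, εup, blo, bup, hα, hεlo, hεup, hε, -, hlom, hupm, hlo, hup, hE, hN, hloc⟩ :=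
    hB.bounds
  have hlo0 : ∀ x, blo x ≤ 0 := fun x => (hlo x).trans (by linarith)
  have hup0 : ∀ x, 0 ≤ bup x := fun x => hεup.trans (hup x)
  have hTs : ∀ k, ∀ y ∈ M.D k, Measurable (M.T k y) := fun k y hy =>
    (hM.measurable_T k).comp (measurable_const.prodMk measurable_id : Measurable fun z =>
      ((⟨y, hy⟩ : M.D k), z))
  have hcs : ∀ k, ∀ y ∈ M.D k, Measurable (M.c k y) := fun k y hy =>
    (hR.measurable_c k).comp (measurable_const.prodMk measurable_id : Measurable fun x =>
      ((⟨y, hy⟩ : M.D k), x))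
  have hint : ∀ k, ∀ ν : Mq p q (M.P k), ∀ y ∈ M.D k,
      Integrable (fun z => M.c k y (M.T k y z)) ν.meas ∧
      Integrable (fun z => bup (M.T k y z)) ν.meas ∧
      Integrable (fun z => blo (M.T k y z)) ν.meas := by
    intro k ν y hy
    have := hM.isProb_P k
    obtain ⟨Θ₁, Θ₂, -, -, -, -, hΘ₁, hΘ₂, hle⟩ := hloc k y hy
    have hle' := hle.self_of_nhdsWithin hy
    refine ⟨?_, ?_, ?_⟩
    · exact (ν.integrable_of_memLp hΘ₁).mono' ((hcs k y hy).comp (hTs k y hy)).aestronglyMeasurable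
        (Eventually.of_forall fun z => (hle' z).1)
    · refine (ν.integrable_of_memLp hΘ₂).mono' (hupm.comp (hTs k y hy)).aestronglyMeasurable
        (Eventually.of_forall fun z => ?_)
      rw [Real.norm_of_nonneg (hup0 _)]
      linarith [(hle' z).2, hlo0 (M.T k y z)]
    · refine (ν.integrable_of_memLp hΘ₂).mono' (hlom.comp (hTs k y hy)).aestronglyMeasurable
        (Eventually.of_forall fun z => ?_)
      rw [Real.norm_of_nonpos (hlo0 _)]
      linarith [(hle' z).2, hup0 (M.T k y z)]
  refine ⟨fun x => bup x - blo x, α, hM.isProb_P, hupm.sub hlom, fun x => ?_, hα,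
    hM.measurable_T, hR.measurable_c, hR.mono_cN.measurable, fun x => ?_, ?_, ?_, ?_⟩
  · linarith [hlo x, hup x]
  · obtain ⟨h1, h2⟩ := hN x
    exact abs_le.2 ⟨by linarith [hup0 x], by linarith [hlo0 x]⟩
  · intro k ν hν y hy
    obtain ⟨hc, -, -⟩ := hint k ν y hy
    obtain ⟨h1, -, h2, -⟩ := hE k ν hν y hy
    have habs : ∀ z, |M.c k y (M.T k y z)| =
        max (M.c k y (M.T k y z)) 0 - -max (-M.c k y (M.T k y z)) 0 := fun z => by
      rcases le_total 0 (M.c k y (M.T k y z)) with h | h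
      · rw [abs_of_nonneg h, max_eq_left h, max_eq_right (by linarith)]; ring
      · rw [abs_of_nonpos h, max_eq_right h, max_eq_left (by linarith)]; ring
    simp only [habs]
    have h3 : Integrable (fun z => -max (-M.c k y (M.T k y z)) 0) ν.meas := hc.neg_part.neg
    rw [integral_sub hc.pos_part h3]
    linarith
  · intro k ν hν y hy
    obtain ⟨-, hu, hl⟩ := hint k ν y hy
    obtain ⟨-, h1, -, h2⟩ := hE k ν hν y hy
    rw [integral_sub hu hl]
    linarith
  · intro k y hy
    obtain ⟨Θ₁, Θ₂, -, -, h1, h2, hΘ₁, hΘ₂, hle⟩ := hloc k y hy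
    refine ⟨Θ₁ + Θ₂, hΘ₁.add hΘ₂, hle.mono fun y' hy' z => ?_⟩
    have := hy' z
    exact ⟨by simpa using this.1.trans (le_add_of_nonneg_right (h2 z)),
      by simpa using this.2.trans (le_add_of_nonneg_left (h1 z))⟩

end Bounding

/-! ### Continuation values -/

/-- Convex increasing functions bounded by a multiple of `b`. -/
structure IsContinuation (b V : ℝ → ℝ) : Prop where
  convexOn : ConvexOn ℝ univ V
  monotone : Monotone V
  bounded : ∃ C, 0 ≤ C ∧ ∀ x, |V x| ≤ C * b x

theorem _root_.ConvexOn.continuous_of_univ {V : ℝ → ℝ} (h : ConvexOn ℝ univ V) : Continuous V :=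
  continuousOn_univ.1 (h.continuousOn isOpen_univ)

theorem RealLine.c_le_c {M : Model N A Z p q} (hR : M.RealLine) {k : Fin N} {x x' w w' : ℝ}
    {a : A} (hx : (x, a) ∈ M.D k) (hx' : (x', a) ∈ M.D k) (hle : x ≤ x') (hw : w ≤ w') :
    M.c k (x, a) w ≤ M.c k (x', a) w' := by
  have h := hR.mono_c k a
  exact h (a := (x, w)) (b := (x', w')) ⟨hx, mem_univ _⟩ ⟨hx', mem_univ _⟩ ⟨hle, hw⟩

/-- For the cost term, pick `x'` strictly below `T y` with `c y' x' > t` for `y'` near `y`.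
Semicontinuity of `T` gives `T y' > x'` nearby, and monotonicity of `c` concludes. -/
theorem RealLine.lowerSemicontinuousOn_stage {M : Model N A Z p q} (hR : M.RealLine) (k : Fin N)
    {V : ℝ → ℝ} (hV : Continuous V) (hVm : Monotone V) (z : Z) :
    LowerSemicontinuousOn (fun y => M.stage k V y z) (M.D k) := by
  intro y hy
  refine LowerSemicontinuousWithinAt.add (f := fun y => M.c k y (M.T k y z))
    (g := fun y => V (M.T k y z)) (fun t ht => ?_) ?_
  · have h1 := hR.lsc_c k (y, M.T k y z) ⟨hy, mem_univ _⟩ t ht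
    rw [nhdsWithin_prod_eq, nhdsWithin_univ] at h1
    obtain ⟨pa, ha, pb, hb, hab⟩ := eventually_prod_iff.1 h1
    obtain ⟨x', hx', hlt⟩ := ((hb.filter_mono nhdsWithin_le_nhds).and
      (self_mem_nhdsWithin : Iio (M.T k y z) ∈ 𝓝[<] (M.T k y z))).exists
    filter_upwards [ha, hR.lsc_T k z y hy x' hlt, self_mem_nhdsWithin] with y' h2 h3 h4
    exact (hab h2 hx').trans_le (hR.c_le_c h4 h4 le_rfl h3.le)
  · exact hV.continuousAt.comp_lowerSemicontinuousWithinAt (hR.lsc_T k z y hy) hVm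

theorem RealLine.stage_mono {M : Model N A Z p q} (hR : M.RealLine) {k : Fin N}
    {V : ℝ → ℝ} (hVm : Monotone V) {x x' : ℝ} {a : A} (hx : (x, a) ∈ M.D k)
    (hx' : (x', a) ∈ M.D k) (hle : x ≤ x') (z : Z) :
    M.stage k V (x, a) z ≤ M.stage k V (x', a) z := by
  have hT : M.T k (x, a) z ≤ M.T k (x', a) z := hR.mono_T k a z hx hx' hle
  exact add_le_add (hR.c_le_c hx hx' hle hT) (hVm hT)

theorem RealLine.convexVia_stage {V' : Type*} [AddCommGroup V'] [Module ℝ V'] {ι : A ↪ V'}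
    {M : Model N A Z p q} (hR : M.RealLine) (hC : M.IsConvex ι) (k : Fin N)
    {V : ℝ → ℝ} (hV : ConvexOn ℝ univ V) (hVm : Monotone V) (z : Z) :
    ConvexVia (fun y : ℝ × A => (y.1, ι y.2)) (M.D k) (fun y => M.stage k V y z) := by
  intro u hu v hv w hw s t hs ht hst hφ
  have hT := hC.convex_T k z u hu v hv w hw s t hs ht hst hφ
  have h1 := hC.convex_c k (u, M.T k u z) ⟨hu, mem_univ _⟩ (v, M.T k v z) ⟨hv, mem_univ _⟩
    (w, s * M.T k u z + t * M.T k v z) ⟨hw, mem_univ _⟩ s t hs ht hst (by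
      simp only [Prod.smul_mk, Prod.mk_add_mk, Prod.mk.injEq] at hφ ⊢
      exact ⟨hφ.1, hφ.2, rfl⟩)
  have h2 : M.c k w (M.T k w z) ≤ M.c k w (s * M.T k u z + t * M.T k v z) :=
    hR.c_le_c hw hw le_rfl hT
  have h3 : V (M.T k w z) ≤ s * V (M.T k u z) + t * V (M.T k v z) :=
    (hVm hT).trans (hV.2 (mem_univ _) (mem_univ _) hs ht hst)
  simp only [stage]
  linarith

/-! ### Partial minimization over the actions -/

section PartialMin

variable {V' : Type*} [AddCommGroup V'] [Module ℝ V']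

/-- Minimizing over the admissible actions preserves convexity and monotonicity. -/
theorem RealLine.exists_partialMin {ι : A ↪ V'} {M : Model N A Z p q} (hR : M.RealLine)
    (hC : M.IsConvex ι) (k : Fin N) (hne : ∀ x, ∃ a, (x, a) ∈ M.D k) {G : ℝ × A → ℝ}
    (hlsc : LowerSemicontinuousOn G (M.D k))
    (hconv : ConvexVia (fun y : ℝ × A => (y.1, ι y.2)) (M.D k) G)
    (hmono : ∀ x x' a, (x, a) ∈ M.D k → (x', a) ∈ M.D k → x ≤ x' → G (x, a) ≤ G (x', a)) :
    ∃ m : ℝ → ℝ, (∀ x, ∃ a, (x, a) ∈ M.D k ∧ G (x, a) = m x) ∧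
      (∀ x a, (x, a) ∈ M.D k → m x ≤ G (x, a)) ∧ ConvexOn ℝ univ m ∧ Monotone m := by
  have hex : ∀ x, ∃ a, (x, a) ∈ M.D k ∧ ∀ a', (x, a') ∈ M.D k → G (x, a) ≤ G (x, a') := by
    intro x
    obtain ⟨a, ha, hmin⟩ := LowerSemicontinuousOn.exists_isMinOn
      (s := {a | (x, a) ∈ M.D k}) (f := fun a => G (x, a)) (hne x) (hR.isCompact_D k x)
      (hlsc.comp (g := fun a => (x, a)) (by fun_prop) fun a ha => ha)
    exact ⟨a, ha, fun a' ha' => hmin ha'⟩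
  choose a ha hmin using hex
  refine ⟨fun x => G (x, a x), fun x => ⟨a x, ha x, rfl⟩, fun x a' => hmin x a',
    ⟨convex_univ, fun x _ x' _ s t hs ht hst => ?_⟩, fun x x' hle => ?_⟩
  · obtain ⟨⟨w, c⟩, hw, hweq⟩ := hC.convex_D k ⟨_, ha x, rfl⟩ ⟨_, ha x', rfl⟩ hs ht hst
    obtain rfl : w = s • x + t • x' := congrArg Prod.fst hweq
    exact (hmin _ c hw).trans (hconv _ (ha x) _ (ha x') _ hw s t hs ht hst hweq)
  -- The minimizer at the larger state is still admissible at the smaller one.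
  · have := hR.antitone_D k hle (ha x')
    exact (hmin x _ this).trans (hmono _ _ _ this (ha x') hle)

variable [TopologicalSpace.MetrizableSpace A]

/-- Sequential closedness of the sublevel correspondence `G (x, ·) ≤ m x`: the lower semicontinuous
left side and the continuous right side make the inequality survive limits. It supplies both compact
values and measurability for the argmin. -/
theorem RealLine.exists_subseq_tendsto {M : Model N A Z p q} (hR : M.RealLine) {k : Fin N}
    {G : ℝ × A → ℝ} (hlsc : LowerSemicontinuousOn G (M.D k)) {m : ℝ → ℝ} (hm : Continuous m)
    {xs : ℕ → ℝ} {as : ℕ → A} {x : ℝ} (hx : Tendsto xs atTop (𝓝 x))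
    (has : ∀ j, (xs j, as j) ∈ M.D k) (hle : ∀ j, G (xs j, as j) ≤ m (xs j)) :
    ∃ a, (x, a) ∈ M.D k ∧ G (x, a) ≤ m x ∧
      ∃ φ : ℕ → ℕ, StrictMono φ ∧ Tendsto (as ∘ φ) atTop (𝓝 a) := by
  obtain ⟨a, ha, hcl⟩ := hR.usc_D k xs as x hx has
  obtain ⟨φ, hφ, hlim⟩ := hcl.tendsto_subseq
  refine ⟨a, ha, ?_, φ, hφ, hlim⟩
  by_contra! hlt
  obtain ⟨t, ht1, ht2⟩ := exists_between hlt
  have hxφ := hx.comp hφ.tendsto_atTop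
  have h1 : Tendsto (fun j => (xs (φ j), as (φ j))) atTop (𝓝[M.D k] (x, a)) :=
    tendsto_nhdsWithin_iff.2 ⟨hxφ.prodMk_nhds hlim, Eventually.of_forall fun j => has _⟩
  have h2 : ∀ᶠ j in atTop, m (xs (φ j)) < t :=
    ((hm.tendsto x).comp hxφ).eventually (gt_mem_nhds ht1)
  obtain ⟨j, hj1, hj2⟩ := ((h1.eventually (hlsc _ ha t ht2)).and h2).exists
  exact absurd (hle (φ j)) (not_le.2 (hj2.trans hj1))

theorem RealLine.exists_measurable_argmin [SecondCountableTopology A] [MeasurableSpace A]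
    [BorelSpace A] {M : Model N A Z p q} (hR : M.RealLine) {k : Fin N}
    {G : ℝ × A → ℝ} (hlsc : LowerSemicontinuousOn G (M.D k)) {m : ℝ → ℝ} (hm : Continuous m)
    (hex : ∀ x, ∃ a, (x, a) ∈ M.D k ∧ G (x, a) ≤ m x) :
    ∃ d : ℝ → A, Measurable d ∧ ∀ x, (x, d x) ∈ M.D k ∧ G (x, d x) ≤ m x := by
  let := TopologicalSpace.metrizableSpaceMetric A
  have hΦ : MeasurableCompactValued fun x => {a | (x, a) ∈ M.D k ∧ G (x, a) ≤ m x} := by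
    refine ⟨fun x => IsSeqCompact.isCompact fun as has => ?_, hex, fun C hC =>
      IsClosed.measurableSet (IsSeqClosed.isClosed fun xs x hxs hx => ?_)⟩
    · obtain ⟨a, h1, h2, φ, hφ, hlim⟩ := hR.exists_subseq_tendsto hlsc hm
        (tendsto_const_nhds (x := x)) (fun j => (has j).1) (fun j => (has j).2)
      exact ⟨a, ⟨h1, h2⟩, φ, hφ, hlim⟩
    · choose as has hasC using hxs
      obtain ⟨a, h1, h2, φ, hφ, hlim⟩ := hR.exists_subseq_tendsto hlsc hm hx
        (fun j => (has j).1) (fun j => (has j).2)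
      exact ⟨a, ⟨h1, h2⟩, hC.mem_of_tendsto hlim (Eventually.of_forall fun j => hasC _)⟩
  obtain ⟨d, hd, hd'⟩ := hΦ.exists_selector
  exact ⟨d, hd, hd'⟩

end PartialMin

end Model

/-! ### Saddle points of the one-stage game -/

namespace Model

variable {N : ℕ} {A Z V' : Type*} [TopologicalSpace A] [MeasurableSpace A]
  [MeasurableSpace Z] [AddCommGroup V'] [Module ℝ V'] {ι : A ↪ V'} {p q : ℝ≥0∞}
  {M : Model N A Z p q} {b : ℝ → ℝ} {α : ℝ}

/-- Measurable best replies of nature to a measurable decision rule of the controller. -/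
theorem BoundedBy.exists_bestReply (h : M.BoundedBy b α) {k : Fin N} [CompactSpace (M.Q k)]
    [TopologicalSpace.MetrizableSpace (M.Q k)] [SecondCountableTopology (M.Q k)]
    [Nonempty (M.Q k)] {d : ℝ → A} (hd : Measurable d) (hdD : ∀ x, (x, d x) ∈ M.D k)
    {V : ℝ → ℝ} (hV : Measurable V) {C : ℝ} (hVb : ∀ x, |V x| ≤ C * b x) :
    ∃ γ : ℝ → M.Q k, Measurable γ ∧
      ∀ x ν, M.stageCost k V (x, d x) ν ≤ M.stageCost k V (x, d x) (γ x) :=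
  exists_measurable_argmax (fun _ => h.measurable_stageCost hd hdD measurable_const hV)
    fun x => h.continuous_stageCost (hdD x) hV hVb

variable [p.HolderConjugate q]

theorem BoundedBy.lowerSemicontinuousOn_stageCost [FirstCountableTopology A]
    (h : M.BoundedBy b α) (hR : M.RealLine)
    (k : Fin N) {V : ℝ → ℝ} (hV : Continuous V) (hVm : Monotone V) {C : ℝ}
    (hC : 0 ≤ C) (hVb : ∀ x, |V x| ≤ C * b x) (ν : M.Q k) :
    LowerSemicontinuousOn (fun y => M.stageCost k V y ν) (M.D k) := by
  intro y hy
  have := h.isProb_P k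
  obtain ⟨Θ, hΘ, hle⟩ := h.local_bound k y hy
  have hi := ν.1.integrable_of_memLp hΘ
  refine lowerSemicontinuousWithinAt_integral (Θ := fun z => Θ z + C * Θ z) hy
    (hi.add (hi.const_mul C))
    (fun y' hy' => (h.integrable_stage hy' hV.measurable hVb ν.1).aestronglyMeasurable)
    (hle.mono fun y' hy' z => ?_)
    fun z => hR.lowerSemicontinuousOn_stage k hV hVm z y hy
  obtain ⟨h1, h2⟩ := hy' z
  exact (abs_add_le _ _).trans (add_le_add h1 ((hVb _).trans (mul_le_mul_of_nonneg_left h2 hC)))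

theorem BoundedBy.convexVia_stageCost (h : M.BoundedBy b α) (hR : M.RealLine)
    (hC : M.IsConvex ι) (k : Fin N) {V : ℝ → ℝ} (hV : ConvexOn ℝ univ V) (hVm : Monotone V)
    {C : ℝ} (hVb : ∀ x, |V x| ≤ C * b x) (ν : M.Q k) :
    ConvexVia (fun y : ℝ × A => (y.1, ι y.2)) (M.D k) (fun y => M.stageCost k V y ν) := by
  intro u hu v hv w hw s t hs ht hst hφ
  have hi := fun y (hy : y ∈ M.D k) =>
    h.integrable_stage hy hV.continuous_of_univ.measurable hVb ν.1
  simp only [stageCost]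
  rw [← integral_const_mul, ← integral_const_mul,
    ← integral_add ((hi u hu).const_mul s) ((hi v hv).const_mul t)]
  exact integral_mono (hi w hw) (((hi u hu).const_mul s).add ((hi v hv).const_mul t))
    fun z => hR.convexVia_stage hC k hV hVm z u hu v hv w hw s t hs ht hst hφ

theorem BoundedBy.stageCost_mono_state (h : M.BoundedBy b α) (hR : M.RealLine)
    {k : Fin N} {V : ℝ → ℝ} (hV : Measurable V) (hVm : Monotone V) {C : ℝ}
    (hVb : ∀ x, |V x| ≤ C * b x) (ν : M.Q k) {x x' : ℝ} {a : A} (hx : (x, a) ∈ M.D k)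
    (hx' : (x', a) ∈ M.D k) (hle : x ≤ x') :
    M.stageCost k V (x, a) ν ≤ M.stageCost k V (x', a) ν :=
  integral_mono (h.integrable_stage hx hV hVb ν.1) (h.integrable_stage hx' hV hVb ν.1)
    fun z => hR.stage_mono hVm hx hx' hle z

/-- The value `m` minimizes the worst-case cost `G`; `d` selects minimizers of `G`. Nature's rule
selects from the measures `ν` guaranteeing at least `m x` against every action, a set that is
nonempty by the minimax theorem. Together they form a saddle point with value `m`. -/
theorem BoundedBy.exists_stage_saddle [TopologicalSpace.MetrizableSpace A]
    [SecondCountableTopology A] [BorelSpace A]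
    (h : M.BoundedBy b α) (hR : M.RealLine) (hC : M.IsConvex ι) {k : Fin N}
    [CompactSpace (M.Q k)] [TopologicalSpace.MetrizableSpace (M.Q k)]
    [SecondCountableTopology (M.Q k)] [Nonempty (M.Q k)] (hne : ∀ x, ∃ a, (x, a) ∈ M.D k)
    (hmix : ∀ ν ν' : M.Q k, ∀ s t : ℝ, 0 ≤ s → 0 ≤ t → s + t = 1 → ∃ κ : M.Q k,
      ∀ g : Z → ℝ, MemLp g p (M.P k) →
        ∫ z, g z ∂κ.1.meas = s * ∫ z, g z ∂ν.1.meas + t * ∫ z, g z ∂ν'.1.meas)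
    {V : ℝ → ℝ} (hV : IsContinuation b V) :
    ∃ (d : ℝ → A) (γ : ℝ → M.Q k), Measurable d ∧ (∀ x, (x, d x) ∈ M.D k) ∧ Measurable γ ∧
      IsContinuation b (fun x => M.stageCost k V (x, d x) (γ x)) ∧
      (∀ x ν, M.stageCost k V (x, d x) ν ≤ M.stageCost k V (x, d x) (γ x)) ∧
      ∀ x a, (x, a) ∈ M.D k →
        M.stageCost k V (x, d x) (γ x) ≤ M.stageCost k V (x, a) (γ x) := by
  have hVc := hV.convexOn.continuous_of_univ
  obtain ⟨C, hC0, hVb⟩ := hV.bounded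
  have hcont : ∀ y ∈ M.D k, Continuous (M.stageCost k V y) := fun y hy =>
    h.continuous_stageCost hy hVc.measurable hVb
  have hlsc := h.lowerSemicontinuousOn_stageCost hR k hVc hV.monotone hC0 hVb
  have hconv := h.convexVia_stageCost hR hC k hV.convexOn hV.monotone hVb
  have hmono := fun ν x x' a (hx : (x, a) ∈ M.D k) hx' hle =>
    h.stageCost_mono_state hR (x' := x') hVc.measurable hV.monotone hVb ν hx hx' hle
  -- Worst measures matter only at admissible pairs; elsewhere the choice is arbitrary.
  have hmaxex : ∀ y, ∃ ν, y ∈ M.D k → ∀ ν', M.stageCost k V y ν' ≤ M.stageCost k V y ν := by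
    intro y
    by_cases hy : y ∈ M.D k
    · obtain ⟨ν, -, hν⟩ := isCompact_univ.exists_isMaxOn univ_nonempty (hcont y hy).continuousOn
      exact ⟨ν, fun _ ν' => hν (mem_univ ν')⟩
    · exact ⟨Classical.arbitrary _, fun hy' => absurd hy' hy⟩
  choose μ hμ using hmaxex
  let G : ℝ × A → ℝ := fun y => M.stageCost k V y (μ y)
  have hGlsc : LowerSemicontinuousOn G (M.D k) := by
    intro y hy t ht
    filter_upwards [hlsc (μ y) y hy t ht, self_mem_nhdsWithin] with y' h1 h2
    exact lt_of_lt_of_le h1 (hμ y' h2 (μ y))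
  have hGconv : ConvexVia (fun y : ℝ × A => (y.1, ι y.2)) (M.D k) G := by
    intro u hu v hv w hw s t hs ht hst hφ
    refine (hconv (μ w) u hu v hv w hw s t hs ht hst hφ).trans (add_le_add ?_ ?_)
    · exact mul_le_mul_of_nonneg_left (hμ u hu _) hs
    · exact mul_le_mul_of_nonneg_left (hμ v hv _) ht
  obtain ⟨m, hm1, hm2, hmconv, hmmono⟩ := hR.exists_partialMin hC k hne hGlsc hGconv
    fun x x' a hx hx' hle => (hmono _ x x' a hx hx' hle).trans (hμ _ hx' _)
  have hmc := hmconv.continuous_of_univ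
  -- `g ν x` is the least cost against a fixed `ν`; it is convex, hence continuous, in `x`.
  choose g hg1 hg2 hgconv hgmono using fun ν => hR.exists_partialMin hC k hne (hlsc ν) (hconv ν)
    (hmono ν)
  obtain ⟨d, hd, hd'⟩ := hR.exists_measurable_argmin hGlsc hmc fun x => by
    obtain ⟨a, ha, hae⟩ := hm1 x
    exact ⟨a, ha, hae.le⟩
  have hclx : ∀ x c, IsClosed {ν | ∀ a, (x, a) ∈ M.D k → c ≤ M.stageCost k V (x, a) ν} := by
    intro x c
    simp only [ofPred_forall]
    exact isClosed_iInter fun a => isClosed_iInter fun ha =>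
      isClosed_le continuous_const (hcont _ ha)
  have happrox : ∀ x c, c < m x → ∃ ν, ∀ a ∈ {a | (x, a) ∈ M.D k},
      c ≤ M.stageCost k V (x, a) ν := by
    intro x c hc
    refine exists_forall_le_of_convexLike (f := fun a ν => M.stageCost k V (x, a) ν)
      (hR.isCompact_D k x) (hne x) (fun ν => ?_) ?_ ?_ ?_
    · exact (hlsc ν).comp (g := fun a => (x, a)) (by fun_prop) fun a ha => ha
    · intro u hu v hv s t hs ht hst
      obtain ⟨⟨w, e⟩, hw, hweq⟩ := hC.convex_D k ⟨_, hu, rfl⟩ ⟨_, hv, rfl⟩ hs ht hst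
      obtain rfl : w = x := by
        have : w = s • x + t • x := congrArg Prod.fst hweq
        rw [this, ← add_smul, hst, one_smul]
      exact ⟨e, hw, fun ν => hconv ν _ hu _ hv _ hw s t hs ht hst hweq⟩
    · intro ν ν' s t hs ht hst
      obtain ⟨κ, hκ⟩ := hmix ν ν' s t hs ht hst
      exact ⟨κ, fun a ha => (hκ _ (h.memLp_stage ha hVc.measurable hVb)).ge⟩
    · exact fun a ha => ⟨μ (x, a), hc.trans_le (hm2 x a ha)⟩
  have hΦ : MeasurableCompactValued fun x =>
      {ν : M.Q k | ∀ a, (x, a) ∈ M.D k → m x ≤ M.stageCost k V (x, a) ν} := by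
    refine ⟨fun x => (hclx x _).isCompact, fun x => ?_, fun K hK =>
      IsClosed.measurableSet (IsSeqClosed.isClosed fun xs x hxs hx => ?_)⟩
    -- The minimax theorem only guarantees levels strictly below `m x`; compactness of the ambiguity
    -- set attains the limit level.
    · have hnon : (⋂ j : ℕ, {ν | ∀ a, (x, a) ∈ M.D k →
          m x - 1 / ((j : ℝ) + 1) ≤ M.stageCost k V (x, a) ν}).Nonempty := by
        refine IsCompact.nonempty_iInter_of_sequence_nonempty_isCompact_isClosed _
          (fun j ν hν a ha => ?_) (fun j => ?_) (hclx x _).isCompact fun j => hclx x _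
        · have h1 : 1 / (((j + 1 : ℕ) : ℝ) + 1) ≤ 1 / ((j : ℝ) + 1) :=
            one_div_le_one_div_of_le (by positivity) (by push_cast; linarith)
          linarith [hν a ha]
        · exact happrox x _ (sub_lt_self _ (by positivity))
      obtain ⟨ν, hν⟩ := hnon
      refine ⟨ν, fun a ha => ?_⟩
      have hlim : Tendsto (fun j : ℕ => m x - 1 / ((j : ℝ) + 1)) atTop (𝓝 (m x - 0)) :=
        tendsto_const_nhds.sub tendsto_one_div_add_atTop_nhds_zero_nat
      rw [sub_zero] at hlim
      exact le_of_tendsto' hlim fun j => mem_iInter.1 hν j a ha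
    · choose νs hνs hνK using hxs
      obtain ⟨ν, -, φ, hφ, hlim⟩ := isCompact_univ.tendsto_subseq fun j => mem_univ (νs j)
      have hxφ := hx.comp hφ.tendsto_atTop
      refine ⟨ν, fun a ha => ?_, hK.mem_of_tendsto hlim (Eventually.of_forall fun j => hνK _)⟩
      -- An action admissible at `x` need not be admissible at `xs j`, so the limit is taken through
      -- states `x' > x`: their actions are admissible at `xs j` once `xs j < x'`, and costs there
      -- are no larger than at `x'`. Continuity of `g ν` then lets `x'` decrease to `x`.
      have hright : ∀ x', x < x' → m x ≤ g ν x' := by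
        intro x' hx'
        obtain ⟨a', ha', hae⟩ := hg1 ν x'
        rw [← hae]
        refine le_of_tendsto_of_tendsto ((hmc.tendsto x).comp hxφ)
          (((hcont _ ha').tendsto ν).comp hlim) ?_
        filter_upwards [hxφ.eventually (gt_mem_nhds hx')] with j hj
        have ha'' : (xs (φ j), a') ∈ M.D k := hR.antitone_D k (le_of_lt hj) ha'
        exact (hνs (φ j) a' ha'').trans (hmono _ _ _ _ ha'' ha' (le_of_lt hj))
      have hgc : Tendsto (g ν) (𝓝[>] x) (𝓝 (g ν x)) :=
        ((hgconv ν).continuous_of_univ.tendsto x).mono_left nhdsWithin_le_nhds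
      have h1 : m x ≤ g ν x := ge_of_tendsto hgc
        (eventually_nhdsWithin_of_forall fun x' hx' => hright x' hx')
      exact h1.trans (hg2 ν x a ha)
  obtain ⟨γ, hγ, hγ'⟩ := hΦ.exists_selector
  have hup : ∀ x ν, M.stageCost k V (x, d x) ν ≤ m x := fun x ν =>
    (hμ _ (hd' x).1 ν).trans (hd' x).2
  have heq : ∀ x, M.stageCost k V (x, d x) (γ x) = m x := fun x =>
    le_antisymm (hup x _) (hγ' x _ (hd' x).1)
  refine ⟨d, γ, hd, fun x => (hd' x).1, hγ, ?_, fun x ν => ?_, fun x a ha => ?_⟩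
  · simp only [heq]
    refine ⟨hmconv, hmmono, 1 + C * α, ?_, fun x => ?_⟩
    · have := h.alpha_nonneg; positivity
    · rw [← heq]
      exact h.abs_stageCost_le (hd' x).1 hC0 hVb (γ x)
  · rw [heq]; exact hup x ν
  · rw [heq]; exact hγ' x a ha

end Model

/-! ### Saddle points and min-max statements -/

/-- A saddle point identifies the value, but attainment of the inner maximum against every `a` does
not follow from it and is asked for separately. -/
theorem isMinMax_of_saddle {α β : Type*} {S : Set α} {G : Set β} {f : α → β → ℝ} {a₀ : α} {b₀ : β}
    (ha₀ : a₀ ∈ S) (hb₀ : b₀ ∈ G) (hmax : ∀ a ∈ S, ∃ b ∈ G, ∀ b' ∈ G, f a b' ≤ f a b)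
    (h₁ : ∀ b ∈ G, f a₀ b ≤ f a₀ b₀) (h₂ : ∀ a ∈ S, f a₀ b₀ ≤ f a b₀) :
    IsMinMax S G f (f a₀ b₀ : EReal) := by
  refine ⟨hmax, ⟨a₀, ha₀, le_antisymm ?_ ?_⟩, ?_⟩
  · exact iSup₂_le fun b hb => EReal.coe_le_coe_iff.2 (h₁ b hb)
  · exact le_iSup₂ (f := fun b (_ : b ∈ G) => (f a₀ b : EReal)) b₀ hb₀
  · rintro _ ⟨a, ha, rfl⟩
    exact (EReal.coe_le_coe_iff.2 (h₂ a ha)).trans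
      (le_iSup₂ (f := fun b (_ : b ∈ G) => (f a b : EReal)) b₀ hb₀)

theorem isMaxMin_of_saddle {α β : Type*} {S : Set α} {G : Set β} {f : β → α → ℝ} {a₀ : α} {b₀ : β}
    (ha₀ : a₀ ∈ S) (hb₀ : b₀ ∈ G) (h₁ : ∀ b ∈ G, f b a₀ ≤ f b₀ a₀)
    (h₂ : ∀ a ∈ S, f b₀ a₀ ≤ f b₀ a) : IsMaxMin G S f (f b₀ a₀ : EReal) := by
  refine ⟨⟨⟨b₀, hb₀, le_antisymm ?_ ?_⟩, ?_⟩, b₀, hb₀, a₀, ha₀, fun a ha => h₂ a ha, rfl⟩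
  · exact iInf₂_le (f := fun a (_ : a ∈ S) => (f b₀ a : EReal)) a₀ ha₀
  · exact le_iInf₂ fun a ha => EReal.coe_le_coe_iff.2 (h₂ a ha)
  · rintro _ ⟨b, hb, rfl⟩
    exact (iInf₂_le (f := fun a (_ : a ∈ S) => (f b a : EReal)) a₀ ha₀).trans
      (EReal.coe_le_coe_iff.2 (h₁ b hb))

namespace Mq

variable {Z : Type*} [MeasurableSpace Z] {μ : Measure Z} {p q : ℝ≥0∞}

/-- Norm bounded weak* closed sets of measures are compact and metrizable. -/
theorem compact_metrizable [IsProbabilityMeasure μ] [IsSeparable μ] (hpq : p.HolderConjugate q)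
    (hq : 1 < q) {S : Set (Mq p q μ)} {K : ℝ} (hK : ∀ ν ∈ S, ‖ν.density‖ ≤ K)
    (hS : IsClosed[weakStar p q μ] (density '' S)) :
    CompactSpace S ∧ TopologicalSpace.MetrizableSpace S ∧ SecondCountableTopology S := by
  have : Fact (1 ≤ p) := ⟨ENNReal.HolderConjugate.one_le p q⟩
  have : Fact (1 ≤ q) := ⟨hq.le⟩
  -- An infinite `p` would force `q = 1`. Finiteness of `p` is needed for separability of `L^p` and
  -- for the duality.
  have hp : p ≠ ∞ := by
    rintro rfl
    have := ENNReal.HolderConjugate.inv_add_inv_eq_one ∞ q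
    simp only [ENNReal.inv_top, zero_add, ENNReal.inv_eq_one] at this
    exact hq.ne' this
  have : Fact (p ≠ ∞) := ⟨hp⟩
  obtain ⟨j, hj⟩ := exists_isEmbedding hK
  exact ⟨isCompact_iff_compactSpace.1 (isCompact_of_isClosed hp hK hS), hj.metrizableSpace,
    hj.secondCountableTopology⟩

end Mq

/-! ### From one stage to the multistage game -/

namespace Model

variable {N : ℕ} {A Z : Type*} [TopologicalSpace A] [MeasurableSpace A] [MeasurableSpace Z]
  {p q : ℝ≥0∞} [p.HolderConjugate q] {M : Model N A Z p q} {b : ℝ → ℝ} {α : ℝ}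

/-- Values of policies are the solutions of the value iteration. -/
theorem BoundedBy.value_eq_of_iteration (h : M.BoundedBy b α) {act : Fin N → ℝ → A}
    (hact : act ∈ M.ctrlX) {amb : ∀ k, ℝ → M.Q k} (hamb : amb ∈ M.natX) {W : Fin (N + 1) → ℝ → ℝ}
    (hlast : W (Fin.last N) = M.cN)
    (hstep : ∀ (k : Fin N) x, W k.castSucc x = M.stageCost k (W k.succ) (x, act k x) (amb k x))
    (n : Fin (N + 1)) : M.value act amb n = W n := by
  induction n using Fin.reverseInduction with
  | last => ext x; rw [h.value_last hact, hlast]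
  | cast k ih => ext x; rw [h.value_castSucc hact hamb, ih, hstep]

/-- Stagewise comparison of two pairs of policies, with the continuation value of the larger. -/
theorem BoundedBy.value_le_value_of_right (h : M.BoundedBy b α) {act act' : Fin N → ℝ → A}
    (hact : act ∈ M.ctrlX) (hact' : act' ∈ M.ctrlX) {amb amb' : ∀ k, ℝ → M.Q k}
    (hamb : amb ∈ M.natX) (hamb' : amb' ∈ M.natX)
    (hle : ∀ (k : Fin N) x, M.stageCost k (M.value act' amb' k.succ) (x, act k x) (amb k x) ≤
        M.stageCost k (M.value act' amb' k.succ) (x, act' k x) (amb' k x))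
    (n : Fin (N + 1)) (x : ℝ) : M.value act amb n x ≤ M.value act' amb' n x := by
  induction n using Fin.reverseInduction generalizing x with
  | last => rw [h.value_last hact, h.value_last hact']
  | cast k ih =>
    rw [h.value_castSucc hact hamb, h.value_castSucc hact' hamb']
    obtain ⟨C, -, hC⟩ := h.exists_abs_value_le hact hamb k.succ
    obtain ⟨C', -, hC'⟩ := h.exists_abs_value_le hact' hamb' k.succ
    exact (h.stageCost_mono ((hact k).2 x) (h.measurable_value hact hamb _)
      (h.measurable_value hact' hamb' _) hC hC' ih (amb k x)).trans (hle k x)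

/-- Stagewise comparison of two pairs of policies, with the continuation value of the smaller. -/
theorem BoundedBy.value_le_value_of_left (h : M.BoundedBy b α) {act act' : Fin N → ℝ → A}
    (hact : act ∈ M.ctrlX) (hact' : act' ∈ M.ctrlX) {amb amb' : ∀ k, ℝ → M.Q k}
    (hamb : amb ∈ M.natX) (hamb' : amb' ∈ M.natX)
    (hle : ∀ (k : Fin N) x, M.stageCost k (M.value act amb k.succ) (x, act k x) (amb k x) ≤
        M.stageCost k (M.value act amb k.succ) (x, act' k x) (amb' k x))
    (n : Fin (N + 1)) (x : ℝ) : M.value act amb n x ≤ M.value act' amb' n x := by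
  induction n using Fin.reverseInduction generalizing x with
  | last => rw [h.value_last hact, h.value_last hact']
  | cast k ih =>
    rw [h.value_castSucc hact hamb, h.value_castSucc hact' hamb']
    obtain ⟨C, -, hC⟩ := h.exists_abs_value_le hact hamb k.succ
    obtain ⟨C', -, hC'⟩ := h.exists_abs_value_le hact' hamb' k.succ
    exact (hle k x).trans (h.stageCost_mono ((hact' k).2 x) (h.measurable_value hact hamb _)
      (h.measurable_value hact' hamb' _) hC hC' ih (amb' k x))

/-- Optimal replies of nature in the multistage problem. -/
theorem BoundedBy.exists_optimal_reply (h : M.BoundedBy b α) [∀ k, CompactSpace (M.Q k)]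
    [∀ k, TopologicalSpace.MetrizableSpace (M.Q k)] [∀ k, SecondCountableTopology (M.Q k)]
    [∀ k, Nonempty (M.Q k)] {act : Fin N → ℝ → A} (hact : act ∈ M.ctrlX) :
    ∃ amb ∈ M.natX, ∀ amb' ∈ M.natX, ∀ n x, M.value act amb' n x ≤ M.value act amb n x := by
  -- Replies are chosen for all measurable dominated `V` at once; the subtype carries these
  -- properties through the recursion defining `W`.
  have hex : ∀ (k : Fin N) (V : {V : ℝ → ℝ // Measurable V ∧ ∃ C, 0 ≤ C ∧ ∀ x, |V x| ≤ C * b x}),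
      ∃ γ : ℝ → M.Q k, Measurable γ ∧ ∀ x ν,
        M.stageCost k V.1 (x, act k x) ν ≤ M.stageCost k V.1 (x, act k x) (γ x) := by
    rintro k ⟨V, hV, C, -, hC⟩
    exact h.exists_bestReply (hact k).1 (hact k).2 hV hC
  choose γ hγ hγ' using hex
  let W : Fin (N + 1) → {V : ℝ → ℝ // Measurable V ∧ ∃ C, 0 ≤ C ∧ ∀ x, |V x| ≤ C * b x} :=
    Fin.reverseInduction (motive := fun _ =>
        {V : ℝ → ℝ // Measurable V ∧ ∃ C, 0 ≤ C ∧ ∀ x, |V x| ≤ C * b x})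
      ⟨M.cN, h.measurable_cN, 1, zero_le_one, fun x => by rw [one_mul]; exact h.abs_cN_le x⟩
      fun k V => ⟨fun x => M.stageCost k V.1 (x, act k x) (γ k V x),
        h.measurable_stageCost (hact k).1 (hact k).2 (hγ k V) V.2.1, by
          obtain ⟨C, hC0, hC⟩ := V.2.2
          exact ⟨1 + C * α, by have := h.alpha_nonneg; positivity, fun x =>
            h.abs_stageCost_le ((hact k).2 x) hC0 hC _⟩⟩
  have hamb : (fun k => γ k (W k.succ)) ∈ M.natX := fun k => hγ k _
  have hval := h.value_eq_of_iteration hact hamb (W := fun n => (W n).1) (by simp [W])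
    (fun k x => by simp [W])
  refine ⟨_, hamb, fun amb' hamb' n x => h.value_le_value_of_right hact hact hamb' hamb (fun k x => ?_) n x⟩
  rw [hval]
  exact hγ' k (W k.succ) x _

/-- Equilibria in the multistage game. -/
theorem BoundedBy.exists_equilibrium {V' : Type*} [AddCommGroup V'] [Module ℝ V'] {ι : A ↪ V'}
    [TopologicalSpace.MetrizableSpace A] [SecondCountableTopology A] [BorelSpace A]
    (h : M.BoundedBy b α) (hR : M.RealLine) (hC : M.IsConvex ι) [∀ k, CompactSpace (M.Q k)]
    [∀ k, TopologicalSpace.MetrizableSpace (M.Q k)] [∀ k, SecondCountableTopology (M.Q k)]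
    [∀ k, Nonempty (M.Q k)] (hne : ∀ k x, ∃ a, (x, a) ∈ M.D k)
    (hmix : ∀ k, ∀ ν ν' : M.Q k, ∀ s t : ℝ, 0 ≤ s → 0 ≤ t → s + t = 1 → ∃ κ : M.Q k,
      ∀ g : Z → ℝ, MemLp g p (M.P k) →
        ∫ z, g z ∂κ.1.meas = s * ∫ z, g z ∂ν.1.meas + t * ∫ z, g z ∂ν'.1.meas) :
    ∃ act ∈ M.ctrlX, ∃ amb ∈ M.natX,
      (∀ amb' ∈ M.natX, ∀ n x, M.value act amb' n x ≤ M.value act amb n x) ∧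
      ∀ act' ∈ M.ctrlX, ∀ n x, M.value act amb n x ≤ M.value act' amb n x := by
  have hex := fun k (V : {V : ℝ → ℝ // IsContinuation b V}) =>
    h.exists_stage_saddle hR hC (hne k) (hmix k) V.2
  choose d γ hd hdD hγ hcon hmax hmin using hex
  let W : Fin (N + 1) → {V : ℝ → ℝ // IsContinuation b V} :=
    Fin.reverseInduction (motive := fun _ => {V : ℝ → ℝ // IsContinuation b V})
      ⟨M.cN, hC.convex_cN, hR.mono_cN, 1, zero_le_one, fun x => by
        rw [one_mul]; exact h.abs_cN_le x⟩
      fun k V => ⟨fun x => M.stageCost k V.1 (x, d k V x) (γ k V x), hcon k V⟩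
  have hact : (fun k => d k (W k.succ)) ∈ M.ctrlX := fun k => ⟨hd k _, hdD k _⟩
  have hamb : (fun k => γ k (W k.succ)) ∈ M.natX := fun k => hγ k _
  have hval := h.value_eq_of_iteration hact hamb (W := fun n => (W n).1) (by simp [W])
    (fun k x => by simp [W])
  -- The stage inequalities are known at the equilibrium continuation value, which is the larger one
  -- when nature deviates and the smaller one when the controller does.
  refine ⟨_, hact, _, hamb, fun amb' hamb' n x => h.value_le_value_of_right hact hact hamb' hamb
    (fun k x => ?_) n x, fun act' hact' n x => h.value_le_value_of_left hact hact' hamb hamb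
    (fun k x => ?_) n x⟩
  · rw [hval]
    exact hmax k (W k.succ) x _
  · rw [hval]
    exact hmin k (W k.succ) x _ ((hact' k).2 x)

end Model

end RobustGame

end

/-! ### The minimax identities and the Nash equilibrium -/

theorem mainTheorem5 {N : ℕ} {A Z V : Type*}
    [TopologicalSpace A] [TopologicalSpace.MetrizableSpace A] [SecondCountableTopology A]
    [MeasurableSpace A] [BorelSpace A] [StandardBorelSpace A]
    [MeasurableSpace Z] [AddCommGroup V] [Module ℝ V] (ι : A ↪ V)
    {p q : ℝ≥0∞} (hpq : p.HolderConjugate q) (hq : 1 < q)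
    (M : RobustGame.Model N A Z p q)
    (hM : M.Standing) (hbound : M.Bounding) (hreal : M.RealLine) (hconv : M.IsConvex ι)
    (hQconv : ∀ k, Convex ℝ (RobustGame.Mq.density '' M.Q k))
    (hQclosed : ∀ k,
      IsClosed[RobustGame.weakStar p q (M.P k)] (RobustGame.Mq.density '' M.Q k)) :
    (∀ (n : Fin (N + 1)) (x : ℝ),
      RobustGame.IsMinMax M.ctrlX M.natXA (M.valueCtrlFirst n x) (M.J n x) ∧
      RobustGame.IsMaxMin M.natX M.ctrlXQ (M.valueNatFirst n x) (M.J n x) ∧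
      M.J n x = M.Jtilde n x ∧
      RobustGame.IsMinMax M.ctrlX M.natX (M.valueSim n x) (M.J n x) ∧
      RobustGame.IsMaxMin M.natX M.ctrlX (fun γ π => M.valueSim n x π γ) (M.J n x)) ∧
    ∃ π ∈ M.ctrlX, ∃ γ ∈ M.natX, ∀ (n : Fin (N + 1)) (x : ℝ),
      (M.valueSim n x π γ : EReal) = M.J n x ∧
      (∀ γ' ∈ M.natX, M.valueSim n x π γ' ≤ M.valueSim n x π γ) ∧
      (∀ π' ∈ M.ctrlX, M.valueSim n x π γ ≤ M.valueSim n x π' γ) := by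
  obtain ⟨b, α, h⟩ := RobustGame.Model.exists_boundedBy hM hbound hreal
  obtain ⟨K, hK⟩ := hbound.normBounded
  have hspace : ∀ k, CompactSpace (M.Q k) ∧ TopologicalSpace.MetrizableSpace (M.Q k) ∧
      SecondCountableTopology (M.Q k) := fun k =>
    have := hM.isProb_P k
    have := hM.separable_P k
    RobustGame.Mq.compact_metrizable hpq hq (hK k) (hQclosed k)
  have := fun k => (hspace k).1
  have := fun k => (hspace k).2.1
  have := fun k => (hspace k).2.2
  have := fun k => (hM.nonempty_Q k).to_subtype
  have : Fact (1 ≤ q) := ⟨hq.le⟩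
  obtain ⟨π, hπ, γ, hγ, hmax, hmin⟩ := h.exists_equilibrium hreal hconv
    (fun k x => by
      obtain ⟨d, -, hd⟩ := hM.exists_selector k
      exact ⟨d x, hd x⟩)
    (fun k ν ν' s t hs ht hst => by
      have := hM.isProb_P k
      obtain ⟨κ, hκ, hκ'⟩ := RobustGame.Mq.exists_integral_eq_of_convex (hQconv k) ν.2 ν'.2 hs ht
        hst
      exact ⟨⟨κ, hκ⟩, hκ'⟩)
  have hreply := fun (π' : Fin N → ℝ → A) (hπ' : π' ∈ M.ctrlX) => h.exists_optimal_reply hπ'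
  -- State rules are rules that ignore the action. Conversely, against a fixed `π'` a rule that sees
  -- the action reduces to a state rule, so optimal state replies are optimal among all rules.
  have hXA : ∀ γ' ∈ M.natX, (fun k (u : ℝ × A) => γ' k u.1) ∈ M.natXA := fun γ' hγ' k =>
    (hγ' k).comp measurable_fst
  have hsub : ∀ γ' ∈ M.natXA, ∀ π' ∈ M.ctrlX, (fun k x => γ' k (x, π' k x)) ∈ M.natX :=
    fun γ' hγ' π' hπ' k => (hγ' k).comp (measurable_id.prodMk (hπ' k).1)
  have hminmax : ∀ n x, RobustGame.IsMinMax M.ctrlX M.natXA (M.valueCtrlFirst n x)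
      (M.value π γ n x : EReal) := fun n x =>
    RobustGame.isMinMax_of_saddle (f := M.valueCtrlFirst n x) (a₀ := π)
      (b₀ := fun k (u : ℝ × A) => γ k u.1) hπ (hXA γ hγ)
      (fun π' hπ' => by
        obtain ⟨γ', hγ', hle⟩ := hreply π' hπ'
        exact ⟨_, hXA γ' hγ', fun γ'' hγ'' => hle _ (hsub γ'' hγ'' π' hπ') n x⟩)
      (fun γ' hγ' => hmax _ (hsub γ' hγ' π hπ) n x) (fun π' hπ' => hmin π' hπ' n x)
  have hJ : ∀ n x, M.J n x = (M.value π γ n x : EReal) := fun n x => by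
    rw [RobustGame.Model.J, ← sInf_image]
    exact (hminmax n x).2.csInf_eq
  have hmaxmin : ∀ n x, RobustGame.IsMaxMin M.natX M.ctrlXQ (M.valueNatFirst n x)
      (M.value π γ n x : EReal) := fun n x =>
    RobustGame.isMaxMin_of_saddle (f := M.valueNatFirst n x)
      (a₀ := fun k (u : ℝ × M.Q k) => π k u.1) (b₀ := γ)
      (fun k => ⟨(hπ k).1.comp measurable_fst, fun y _ => (hπ k).2 y⟩) hγ
      (fun γ' hγ' => hmax γ' hγ' n x)
      -- Against the fixed `γ`, a controller rule reading the measure is the state rule `y ↦ π' k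
      -- (y, γ k y)`.
      (fun π' hπ' => hmin (fun k y => π' k (y, γ k y))
        (fun k => ⟨(hπ' k).1.comp (measurable_id.prodMk (hγ k)), fun y => (hπ' k).2 y _⟩) n x)
  refine ⟨fun n x => ?_, π, hπ, γ, hγ, fun n x => ⟨(hJ n x).symm, fun γ' hγ' => hmax γ' hγ' n x,
    fun π' hπ' => hmin π' hπ' n x⟩⟩
  rw [hJ]
  refine ⟨hminmax n x, hmaxmin n x, ?_, ?_, ?_⟩
  · rw [RobustGame.Model.Jtilde, ← sSup_image]
    exact (hmaxmin n x).1.csSup_eq.symm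
  · exact RobustGame.isMinMax_of_saddle (f := M.valueSim n x) (a₀ := π) (b₀ := γ) hπ hγ
      (fun π' hπ' => by
        obtain ⟨γ', hγ', hle⟩ := hreply π' hπ'
        exact ⟨γ', hγ', fun γ'' hγ'' => hle γ'' hγ'' n x⟩)
      (fun γ' hγ' => hmax γ' hγ' n x) (fun π' hπ' => hmin π' hπ' n x)
  · exact RobustGame.isMaxMin_of_saddle (f := fun γ π => M.valueSim n x π γ) (a₀ := π)
      (b₀ := γ) hπ hγ
      (fun γ' hγ' => hmax γ' hγ' n x) (fun π' hπ' => hmin π' hπ' n x)
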